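/- **Setting.** Let $n\ge 0$ and let $\mathcal G_{n+1}$ be the set of simple graphs on the nodes $1,\dots,n+1$. A labeled forest is an acyclic graph in $\mathcal G_{n+1}$; each component is rooted at its node with the largest label. The *neighbor-first search* (NFS) on $G\in\mathcal G_{n+1}$ treats the components in decreasing order of their largest labels. In each component it first visits the node with the largest label and makes it active. At each step it visits the unvisited neighbors of the active node in decreasing order of labels, and the most recently visited node that has not yet been active becomes the new active node. The edges along which new nodes are visited form the search forest $\Phi(G)$. Each node gets a position $0,1,\dots,n$, in the order in which the nodes are visited. A *cane path* in a labeled forest $F$ is a path of length $k\ge2$ whose first $k-1$ steps go from a node to its parent and whose last step goes from a node to a child with a larger label than the child the path has just come from. Let $\alpha(F)$ be the number of cane paths in $F$, and $E(G)$ the edge set of $G$. For a point $(x_1,\dots,x_n)\in\mathbb R^n$ put $x_0=1$. For $t\ge0$, a labeled forest $F$ on $n+1$ nodes and a node $k$, put $c(k,F;t)=t\,x_l$ if $k$ is the root of its component and $l$ is its NFS position in $F$; otherwise put $c(k,F;t)=x_i/(1+t)^j-x_l$, where $i$ is the NFS position of $k$, $j$ the number of cane paths starting in $k$, and $l$ the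 NFS position of the root of the component of $k$. Let $$\mathbf S_F(t)=\{(x_1,\dots,x_n): 0\le c(1,F;t)\le c(2,F;t)\le\dots\le c(n+1,F;t)=t\},$$ $$\mathbf G_n(t)=\{(x_1,\dots,x_n): 0\le x_i\le(1+t)x_{i-1}\ \text{ for } i=1,\dots,n\}.$$ **Theorem.** (a) Let $t\ge 0$ (with $0^0=1$). For every labeled forest $F$ on $n+1$ nodes, $$\sum_{G\in\mathcal G_{n+1},\ \Phi(G)=F}t^{|E(G)|}=t^{|E(F)|}(1+t)^{\alpha(F)},$$ and $$n!\,\mathrm{vol}\,\mathbf G_n(t)=\sum_{G\in\mathcal G_{n+1}}t^{|E(G)|}=(1+t)^{\binom{n+1}2}.$$ (b) Let $t>0$. For every labeled forest $F$ on $n+1$ nodes, $\mathbf S_F(t)$ is an $n$-simplex and $$n!\,\mathrm{vol}\,\mathbf S_F(t)=\sum_{G\in\mathcal G_{n+1},\ \Phi(G)=F}t^{|E(G)|}.$$ The simplices $\mathbf S_F(t)$, where $F$ runs over all labeled forests on $n+1$ nodes, triangulate $\mathbf G_n(t)$: their union is $\mathbf G_n(t)$, simplices of different forests have disjoint interiors,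 and any two of the simplices meet in a common (possibly empty) face. (c) The simplices are not orthoschemes in general: for every $t>0$ there are an $n$ and a labeled forest $F$ on $n+1$ nodes such that $\mathbf S_F(t)$ does not arise by permuting and translating coordinates from a simplex with vertices $(0,\dots,0),(\ell_1,0,\dots,0),(\ell_1,\ell_2,0,\dots,0),\dots,(\ell_1,\dots,\ell_n)$ with all $\ell_i\neq0$. -/

import Mathlib

namespace TGayley

open scoped Nat ENNReal

noncomputable section

/-! ### Neighbor-first search

The nodes are the elements of a finite linear order `V`; for graphs on `n + 1` nodes we use
`V = Fin (n + 1)`, the element `k` carrying the label `k + 1`. -/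

/-- State of the neighbor-first search: the nodes visited so far, in the order of their visits;
the visited nodes that have not yet been active, the most recently visited one first; and the edges
(parent, child) of the search forest found so far. -/
structure NFSState (V : Type*) where
  visited : List V
  pending : List V
  tree : List (V × V)

open Classical in
/-- The neighbors of `v` that are not in the list `visited`, in decreasing order of labels. -/
def unvisitedNeighbors {V : Type*} [Fintype V] [LinearOrder V] (G : SimpleGraph V)
    (visited : List V) (v : V) : List V :=
  (Finset.univ.filter (fun w => G.Adj v w ∧ w ∉ visited)).sort (· ≥ ·)

/-- Make the visited node `v` active, `rest` being the other pending nodes: its unvisited neighbors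
are visited in decreasing order of labels, each giving an edge of the search forest. The pending
list begins with the neighbor visited last, that is, with the one with the smallest label. -/
def activate {V : Type*} [Fintype V] [LinearOrder V] (G : SimpleGraph V)
    (s : NFSState V) (v : V) (rest : List V) : NFSState V where
  visited := s.visited ++ unvisitedNeighbors G s.visited v
  pending := (unvisitedNeighbors G s.visited v).reverse ++ rest
  tree := s.tree ++ (unvisitedNeighbors G s.visited v).map (fun w => (v, w))

/-- One step of the search: the last visited node that has not been active becomes active. If there
is none, the components entered so far are exhausted; then the search visits the largest unvisited
label (the largest label of the next component, the components being ordered by decreasing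
largest labels) and makes it active. If all nodes have been visited, nothing happens. -/
def nfsStep {V : Type*} [Fintype V] [LinearOrder V] (G : SimpleGraph V)
    (s : NFSState V) : NFSState V :=
  match s.pending with
  | v :: rest => activate G s v rest
  | [] =>
    if h : (Finset.univ.filter (fun w => w ∉ s.visited)).Nonempty then
      activate G
        { s with visited := s.visited ++ [(Finset.univ.filter (fun w => w ∉ s.visited)).max' h] }
        ((Finset.univ.filter (fun w => w ∉ s.visited)).max' h) []
    else s

/-- The final state of the search. Every step makes one new node active, so the search is complete
after as many steps as there are nodes. -/
def nfs {V : Type*} [Fintype V] [LinearOrder V] (G : SimpleGraph V) : NFSState V :=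
  (nfsStep G)^[Fintype.card V] ⟨[], [], []⟩

/-- The search forest `Φ(G)`. -/
def Phi {V : Type*} [Fintype V] [LinearOrder V] (G : SimpleGraph V) : SimpleGraph V :=
  SimpleGraph.fromRel (fun u v => (u, v) ∈ (nfs G).tree)

/-- The position `0, 1, 2, …` of the node `v` in the neighbor-first search on `G`. -/
def position {V : Type*} [Fintype V] [LinearOrder V] (G : SimpleGraph V) (v : V) : ℕ :=
  (nfs G).visited.idxOf v

/-! ### Rooted labeled forests and cane paths -/

open Classical in
/-- The root of the component of `v`: the node of this component with the maximal label. -/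
def root {V : Type*} [Fintype V] [LinearOrder V] (F : SimpleGraph V) (v : V) : V :=
  (Finset.univ.filter (fun w => F.Reachable v w)).max'
    ⟨v, Finset.mem_filter.2 ⟨Finset.mem_univ v, SimpleGraph.Reachable.refl v⟩⟩

/-- In the forest `F`, the node `p` is the parent of the node `v`: the neighbor of `v` which is one
step closer to the root of the component. -/
def IsParent {V : Type*} [Fintype V] [LinearOrder V] (F : SimpleGraph V) (p v : V) : Prop :=
  F.Adj v p ∧ F.dist v (root F v) = F.dist p (root F v) + 1

/-- `IsCanePath F l`: the list of nodes `l` is a cane path of `F`, that is, a path of length at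
least `2` all of whose steps but the last are steps from a node to its parent, and whose last step
is down right: if the last up step is `u → p`, the last step goes from `p` to a child `w` of `p`
with a larger label than `u`. -/
inductive IsCanePath {V : Type*} [Fintype V] [LinearOrder V] (F : SimpleGraph V) : List V → Prop
  | bend {u p w : V} (hu : IsParent F p u) (hw : IsParent F p w) (huw : u < w) :
      IsCanePath F [u, p, w]
  | up {u p : V} {l : List V} (hu : IsParent F p u) (h : IsCanePath F (p :: l)) :
      IsCanePath F (u :: p :: l)

/-- The number of cane paths of `F` that start in `v`. -/
def numCanePaths {V : Type*} [Fintype V] [LinearOrder V] (F : SimpleGraph V) (v : V) : ℕ :=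
  {l : List V | IsCanePath F l ∧ l.head? = some v}.ncard

/-- `α(F)`: the sum of the numbers of cane paths starting in the nodes that are not roots. -/
def alpha {V : Type*} [Fintype V] [LinearOrder V] (F : SimpleGraph V) : ℕ :=
  ∑ v ∈ Finset.univ.filter (fun v => v ≠ root F v), numCanePaths F v

/-! ### The simplices and the `t`-Gayley polytope

A point `(x₁, …, xₙ)` is a function `x : Fin n → ℝ` with `x i` in the role of `x_{i+1}`. -/

/-- The coordinates `x₀, x₁, …, xₙ` of a point, where `x₀ = 1`. (The value `0` at indices above `n`
is never used.) -/
def xCoord {n : ℕ} (x : Fin n → ℝ) : ℕ → ℝ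
  | 0 => 1
  | i + 1 => if h : i < n then x ⟨i, h⟩ else 0

/-- The coordinate `c(k, F; t)` attached to the node `k` of the forest `F`: it is `t x_l` for a root
in position `l`, and `x_i / (1 + t) ^ j - x_l` for any other node, where `i` is its position, `j` the
number of cane paths starting in it, and `l` the position of the root of its component. -/
def coord {n : ℕ} (F : SimpleGraph (Fin (n + 1))) (t : ℝ) (x : Fin n → ℝ) (k : Fin (n + 1)) : ℝ :=
  if k = root F k then t * xCoord x (position F k)
  else xCoord x (position F k) / (1 + t) ^ numCanePaths F k - xCoord x (position F (root F k))

/-- `S_F(t) = {x : 0 ≤ c(1, F; t) ≤ c(2, F; t) ≤ … ≤ c(n + 1, F; t) = t}`. -/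
def forestSimplex {n : ℕ} (F : SimpleGraph (Fin (n + 1))) (t : ℝ) : Set (Fin n → ℝ) :=
  {x | 0 ≤ coord F t x 0 ∧ Monotone (coord F t x) ∧ coord F t x (Fin.last n) = t}

/-- The `t`-Gayley polytope: `0 ≤ x₁ ≤ 1 + t` and `0 ≤ xᵢ ≤ (1 + t) xᵢ₋₁` for `2 ≤ i ≤ n`. Since
`xCoord x 0 = 1`, the case `i = 0` below is the condition on `x₁`. -/
def gayleyPolytope (n : ℕ) (t : ℝ) : Set (Fin n → ℝ) :=
  {x | ∀ i : Fin n, 0 ≤ x i ∧ x i ≤ (1 + t) * xCoord x i}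

/-! ### Simplices, orthoschemes, triangulations -/

/-- `S` is an `n`-simplex in `ℝⁿ`: the convex hull of `n + 1` affinely independent points. -/
def IsFullSimplex {n : ℕ} (S : Set (Fin n → ℝ)) : Prop :=
  ∃ v : Fin (n + 1) → (Fin n → ℝ), AffineIndependent ℝ v ∧ S = convexHull ℝ (Set.range v)

/-- The simplex `O(ℓ₁, …, ℓₙ)` with vertices `(0, …, 0)`, `(ℓ₁, 0, …, 0)`, `(ℓ₁, ℓ₂, 0, …, 0)`, …,
`(ℓ₁, …, ℓₙ)`. -/
def pathSimplex {n : ℕ} (ℓ : Fin n → ℝ) : Set (Fin n → ℝ) :=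
  convexHull ℝ (Set.range fun (k : Fin (n + 1)) (i : Fin n) => if (i : ℕ) < k then ℓ i else 0)

/-- `S` is a Schläfli orthoscheme: it arises from some `O(ℓ₁, …, ℓₙ)` by permuting and translating
the coordinates. -/
def IsOrthoscheme {n : ℕ} (S : Set (Fin n → ℝ)) : Prop :=
  ∃ (ℓ : Fin n → ℝ) (σ : Equiv.Perm (Fin n)) (b : Fin n → ℝ),
    (∀ i, ℓ i ≠ 0) ∧ S = (fun y i => y (σ i) + b i) '' pathSimplex ℓ

/-- The sets `S i` form a triangulation of `P`: they are `n`-simplices, they cover `P` and lie in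
`P`, different ones have disjoint interiors, and any two of them meet in a common (possibly empty)
face. -/
structure IsTriangulation {n : ℕ} {ι : Type*} (S : ι → Set (Fin n → ℝ))
    (P : Set (Fin n → ℝ)) : Prop where
  simplex : ∀ i, IsFullSimplex (S i)
  cover : ⋃ i, S i = P
  disjoint_interior : ∀ i j, i ≠ j → Disjoint (interior (S i)) (interior (S j))
  inter_face : ∀ i j, IsExposed ℝ (S i) (S i ∩ S j) ∧ IsExposed ℝ (S j) (S i ∩ S j)

end

end TGayley

namespace TGayley

open scoped Nat ENNReal

noncomputable section

/-! ### The run of the neighbor-first search -/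

section Run

variable {V : Type*} [Fintype V] [LinearOrder V]

/-! When a node `v` becomes active, the search looks only at its edges to unvisited nodes. Every
edge of `G` outside the search forest joins some `v` to a node that is already pending when `v`
becomes active (`IsCane`), and adding or deleting such canes does not change the search. So the
graphs with search forest `F` form the interval from `F` to `F ⊔ caneGraph F` (`phi_eq_iff`). In the
search on `F`, the nodes pending behind `v` at that moment are as many as the cane paths starting in
`v`, because both numbers obey the same recursion along parents (`numCanePaths_of_isParent`,
`IsStack`). This gives the generating function of a fiber.

The node coordinates identify the simplex of `F` affinely with the order simplex `0 ≤ y₁ ≤ … ≤ yₙ ≤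
t`. The value at a node involves only its own coordinate and that of its root, which has a larger
label; so the matrix is triangular and its determinant gives the volume (`abs_det_pointMatrix`). The
polytope is a rescaled order simplex as well (`gayleyPolytope_eq_image`).

The triangulation rests on one observation: for `x` in the simplex of `F`, the value at the root of
a node is the minimum of `x₀, …, x_i`, where `i` is the position of the node
(`isLeast_xCoord_root`). This minimum does not refer to `F`. For interior `x`, comparing `x_i` with
it and with its multiples by powers of `1 + t` recovers the roots, the numbers of cane paths and the
node coordinates, whose order gives the labels; these data determine `F` (`eq_of_visited_eq`). Hence
interiors are disjoint. The relation `Follows` between consecutive nodes puts the simplices into the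
polytope, and since the volumes add up, their closed union is the whole polytope
(`iUnion_forestSimplex`).

For the faces, let `x` lie in the simplex of `F` and switch the node coordinates to `t` or `0`
according to whether they exceed a level `s`. The resulting vertex depends on `x` and `s` only
(`pointOf_threshold_eq`), so all simplices containing `x` share the vertices that carry `x`.
Finally, the forest `smallEdge` gives a triangle with just one edge parallel to an axis, whereas a
planar orthoscheme has two. -/

theorem mem_unvisitedNeighbors {G : SimpleGraph V} {L : List V} {v w : V} :
    w ∈ unvisitedNeighbors G L v ↔ G.Adj v w ∧ w ∉ L := by
  simp [unvisitedNeighbors]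

theorem nodup_unvisitedNeighbors (G : SimpleGraph V) (L : List V) (v : V) :
    (unvisitedNeighbors G L v).Nodup :=
  Finset.sort_nodup _ _

theorem pairwise_unvisitedNeighbors (G : SimpleGraph V) (L : List V) (v : V) :
    (unvisitedNeighbors G L v).Pairwise (· > ·) := by
  have h1 : (unvisitedNeighbors G L v).Pairwise (· ≥ ·) := Finset.pairwise_sort _ _
  have h2 := nodup_unvisitedNeighbors G L v
  exact (h1.and h2).imp fun h => lt_of_le_of_ne h.1 (Ne.symm h.2)

/-- If no node is pending, visit the largest unvisited node and make it pending. -/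
def enterComponent (s : NFSState V) : NFSState V :=
  match s.pending with
  | _ :: _ => s
  | [] =>
    if h : (Finset.univ.filter (fun w => w ∉ s.visited)).Nonempty then
      ⟨s.visited ++ [(Finset.univ.filter (fun w => w ∉ s.visited)).max' h],
        [(Finset.univ.filter (fun w => w ∉ s.visited)).max' h], s.tree⟩
    else s

/-- The state of the search after `k` steps. -/
def stateAt (G : SimpleGraph V) (k : ℕ) : NFSState V := (nfsStep G)^[k] ⟨[], [], []⟩

theorem stateAt_zero (G : SimpleGraph V) : stateAt G 0 = ⟨[], [], []⟩ := rfl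

theorem stateAt_succ (G : SimpleGraph V) (k : ℕ) :
    stateAt G (k + 1) = nfsStep G (stateAt G k) :=
  Function.iterate_succ_apply' _ _ _

/-- Separating the entry into a component from the activation leaves a single kind of step to
analyse: both branches of `nfsStep` activate the head of the pending list of `enterComponent s`. -/
theorem nfsStep_eq_activate {G : SimpleGraph V} {s : NFSState V} {v : V} {rest : List V}
    (h : (enterComponent s).pending = v :: rest) :
    nfsStep G s = activate G (enterComponent s) v rest := by
  unfold nfsStep
  unfold enterComponent at h ⊢
  split
  · rename_i a b hab
    rw [hab] at h
    simp only [hab] at h ⊢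
    obtain ⟨rfl, rfl⟩ := List.cons.inj h
    rfl
  · rename_i hab
    simp only [hab] at h ⊢
    split
    · rename_i hne
      simp only [hne, dif_pos] at h
      obtain ⟨rfl, rfl⟩ := List.cons.inj h
      rfl
    · rename_i hne
      simp [hne, hab] at h

theorem nfsStep_eq_self {G : SimpleGraph V} {s : NFSState V}
    (h : (enterComponent s).pending = []) : nfsStep G s = s := by
  unfold nfsStep
  unfold enterComponent at h
  split
  · rename_i a b hab
    simp [hab] at h
  · rename_i hab
    simp only [hab] at h
    split
    · rename_i hne
      simp [hne] at h
    · rfl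

/-- The states that occur in the search on `G`, including those in which the first node of a new
component has been visited and not yet been made active. -/
inductive Reached (G : SimpleGraph V) : NFSState V → Prop
  | init : Reached G ⟨[], [], []⟩
  | root {s : NFSState V} {m : V} (hs : Reached G s) (hp : s.pending = []) (hm : m ∉ s.visited)
      (hmax : ∀ w, w ∉ s.visited → w ≤ m) : Reached G ⟨s.visited ++ [m], [m], s.tree⟩
  | activate {s : NFSState V} {v : V} {rest : List V} (hs : Reached G s)
      (hp : s.pending = v :: rest) : Reached G (activate G s v rest)

theorem Reached.enterComponent {G : SimpleGraph V} {s : NFSState V} (hs : Reached G s) :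
    Reached G (enterComponent s) := by
  unfold TGayley.enterComponent
  split
  · exact hs
  · rename_i hp
    split
    · rename_i hne
      have hmem := Finset.max'_mem _ hne
      refine Reached.root hs hp (by simpa using hmem) fun w hw => ?_
      exact Finset.le_max' _ _ (by simpa using hw)
    · exact hs

theorem reached_stateAt (G : SimpleGraph V) (k : ℕ) : Reached G (stateAt G k) := by
  induction k with
  | zero => exact Reached.init
  | succ k ih =>
    rw [stateAt_succ]
    rcases h : (TGayley.enterComponent (stateAt G k)).pending with _ | ⟨v, rest⟩
    · rwa [nfsStep_eq_self h]
    · rw [nfsStep_eq_activate h]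
      exact Reached.activate ih.enterComponent h

/-- The basic properties of a state of the search. -/
structure IsSound (G : SimpleGraph V) (s : NFSState V) : Prop where
  visited_nodup : s.visited.Nodup
  pending_nodup : s.pending.Nodup
  pending_sub : ∀ v ∈ s.pending, v ∈ s.visited
  -- A visited node that is no longer pending has been active.
  closed : ∀ v ∈ s.visited, v ∉ s.pending → ∀ w, G.Adj v w → w ∈ s.visited
  tree_mem : ∀ p w, (p, w) ∈ s.tree → p ∈ s.visited ∧ w ∈ s.visited ∧ G.Adj p w
  tree_unique : ∀ p q w, (p, w) ∈ s.tree → (q, w) ∈ s.tree → p = q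
  tree_lt : ∀ p w, (p, w) ∈ s.tree → s.visited.idxOf p < s.visited.idxOf w

theorem Reached.isSound {G : SimpleGraph V} {s : NFSState V} (hs : Reached G s) :
    IsSound G s := by
  induction hs with
  | init => constructor <;> simp
  | @root s m hs hp hm hmax ih =>
    have hcl := ih.closed
    simp only [hp, List.not_mem_nil, not_false_eq_true, forall_const] at hcl
    refine ⟨?_, by simp, by simp, ?_, ?_, ih.tree_unique, ?_⟩
    · simpa [List.nodup_append] using ⟨ih.visited_nodup, fun a ha h => hm (h ▸ ha)⟩
    · intro v hv hvm w hvw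
      simp only [List.mem_append, List.mem_singleton] at hv hvm ⊢
      rcases hv with hv | hv
      · exact Or.inl (hcl v hv w hvw)
      · exact absurd hv hvm
    · intro p w h
      obtain ⟨h1, h2, h3⟩ := ih.tree_mem p w h
      simp [h1, h2, h3]
    · intro p w h
      obtain ⟨h1, h2, h3⟩ := ih.tree_mem p w h
      simpa [List.idxOf_append, h1, h2] using ih.tree_lt p w h
  | @activate s v rest hs hp ih =>
    have hv : v ∈ s.visited := ih.pending_sub v (by simp [hp])
    have hnd := ih.pending_nodup
    rw [hp, List.nodup_cons] at hnd
    have hC := fun w => @mem_unvisitedNeighbors V _ _ G s.visited v w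
    have hCn := nodup_unvisitedNeighbors G s.visited v
    have hrest : ∀ w ∈ rest, w ∈ s.visited := fun w hw => ih.pending_sub w (by simp [hp, hw])
    refine ⟨?_, ?_, ?_, ?_, ?_, ?_, ?_⟩ <;> simp only [TGayley.activate]
    · refine List.nodup_append.2 ⟨ih.visited_nodup, hCn, ?_⟩
      rintro a ha b hb rfl
      exact ((hC a).1 hb).2 ha
    · refine List.nodup_append.2 ⟨List.nodup_reverse.2 hCn, hnd.2, ?_⟩
      rintro a ha b hb rfl
      exact ((hC a).1 (by simpa using ha)).2 (hrest a hb)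
    · intro w hw
      simp only [List.mem_append, List.mem_reverse] at hw ⊢
      rcases hw with hw | hw
      · exact Or.inr hw
      · exact Or.inl (hrest w hw)
    · intro u hu hup w huw
      simp only [List.mem_append, List.mem_reverse, not_or] at hu hup ⊢
      have hu' : u ∈ s.visited := by tauto
      by_cases huv : u = v
      · subst huv
        by_cases hw : w ∈ s.visited
        · exact Or.inl hw
        · exact Or.inr ((hC w).2 ⟨huw, hw⟩)
      · exact Or.inl (ih.closed u hu' (by simp [hp, huv, hup.2]) w huw)
    · intro p w h
      simp only [List.mem_append, List.mem_map, Prod.mk.injEq] at h ⊢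
      rcases h with h | ⟨a, ha, rfl, rfl⟩
      · obtain ⟨h1, h2, h3⟩ := ih.tree_mem p w h
        simp [h1, h2, h3]
      · simp [hv, ha, ((hC _).1 ha).1]
    · intro p q w h1 h2
      simp only [List.mem_append, List.mem_map, Prod.mk.injEq] at h1 h2
      rcases h1 with h1 | ⟨a, ha, rfl, rfl⟩ <;> rcases h2 with h2 | ⟨b, hb, rfl, h⟩
      · exact ih.tree_unique p q w h1 h2
      · subst h
        exact absurd (ih.tree_mem _ _ h1).2.1 ((hC _).1 hb).2
      · exact absurd (ih.tree_mem _ _ h2).2.1 ((hC _).1 ha).2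
      · rfl
    · intro p w h
      simp only [List.mem_append, List.mem_map, Prod.mk.injEq] at h
      rcases h with h | ⟨a, ha, rfl, rfl⟩
      · obtain ⟨h1, h2, h3⟩ := ih.tree_mem p w h
        simpa [List.idxOf_append, h1, h2] using ih.tree_lt p w h
      · rw [List.idxOf_append, List.idxOf_append, if_pos hv, if_neg ((hC _).1 ha).2]
        have := List.idxOf_lt_length_iff.2 hv
        omega

theorem isSound_stateAt (G : SimpleGraph V) (k : ℕ) : IsSound G (stateAt G k) :=
  (reached_stateAt G k).isSound

/-! ### Termination: the search visits and activates every node -/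

theorem length_le_card_of_nodup {L : List V} (h : L.Nodup) : L.length ≤ Fintype.card V := by
  rw [← List.toFinset_card_of_nodup h]
  exact Finset.card_le_univ _

theorem enterComponent_pending_cons {s : NFSState V} {a : V} {l : List V}
    (h : s.pending = a :: l) : enterComponent s = s := by
  unfold enterComponent
  split
  · rfl
  · rename_i h'
    rw [h'] at h
    cases h

theorem enterComponent_pending_nil {s : NFSState V} (h : s.pending = [])
    (hex : ∃ w, w ∉ s.visited) :
    ∃ m, m ∉ s.visited ∧ enterComponent s = ⟨s.visited ++ [m], [m], s.tree⟩ := by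
  have hne : (Finset.univ.filter (fun w => w ∉ s.visited)).Nonempty := by
    obtain ⟨w, hw⟩ := hex
    exact ⟨w, by simpa using hw⟩
  refine ⟨(Finset.univ.filter (fun w => w ∉ s.visited)).max' hne, ?_, ?_⟩
  · simpa using Finset.max'_mem _ hne
  · unfold enterComponent
    split
    · rename_i h'
      rw [h] at h'
      cases h'
    · rw [dif_pos hne]

theorem enterComponent_cases (s : NFSState V) :
    enterComponent s = s ∨
      ∃ m, m ∉ s.visited ∧ s.pending = [] ∧ enterComponent s = ⟨s.visited ++ [m], [m], s.tree⟩ := by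
  rcases h : s.pending with _ | ⟨a, l⟩
  · by_cases hex : ∃ w, w ∉ s.visited
    · obtain ⟨m, hm, he⟩ := enterComponent_pending_nil h hex
      exact Or.inr ⟨m, hm, rfl, he⟩
    · left
      unfold enterComponent
      split
      · rfl
      · rw [dif_neg]
        rintro ⟨w, hw⟩
        exact hex ⟨w, by simpa using hw⟩
  · exact Or.inl (enterComponent_pending_cons h)

/-- Each of these steps activates exactly one node: if nothing is pending after `k < Fintype.card V`
steps, only `k` nodes have been visited, so a new component can be entered. At `k = Fintype.card V`
the equation forces the pending list to be empty. -/
theorem length_stateAt (G : SimpleGraph V) {k : ℕ} (hk : k ≤ Fintype.card V) :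
    (stateAt G k).visited.length = (stateAt G k).pending.length + k := by
  induction k with
  | zero => simp [stateAt_zero]
  | succ k ih =>
    have ih := ih (by omega)
    have hs := isSound_stateAt G k
    rw [stateAt_succ]
    rcases h : (stateAt G k).pending with _ | ⟨a, l⟩
    · have hex : ∃ w, w ∉ (stateAt G k).visited := by
        by_contra! hall
        have h1 : (stateAt G k).visited.toFinset = Finset.univ := by
          ext w; simp [hall w]
        have h2 := List.toFinset_card_of_nodup hs.visited_nodup
        rw [h1, Finset.card_univ, ih, h] at h2
        simp at h2
        omega
      obtain ⟨m, hm, he⟩ := enterComponent_pending_nil h hex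
      rw [nfsStep_eq_activate (by rw [he]), he]
      simp only [activate, List.length_append, List.length_reverse, List.length_singleton,
        List.length_nil]
      simp [h] at ih
      omega
    · rw [nfsStep_eq_activate (by rw [enterComponent_pending_cons h, h]),
        enterComponent_pending_cons h]
      simp only [activate, List.length_append, List.length_reverse]
      simp [h] at ih
      omega

theorem nfs_pending (G : SimpleGraph V) : (nfs G).pending = [] := by
  have h1 := length_stateAt G (le_refl (Fintype.card V))
  have h2 := length_le_card_of_nodup (isSound_stateAt G (Fintype.card V)).visited_nodup
  exact List.length_eq_zero_iff.1 (by change (stateAt G (Fintype.card V)).pending.length = 0; omega)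

theorem nfs_visited_length (G : SimpleGraph V) : (nfs G).visited.length = Fintype.card V := by
  have h1 := length_stateAt G (le_refl (Fintype.card V))
  have h2 : (stateAt G (Fintype.card V)).pending = [] := nfs_pending G
  rw [h2] at h1
  exact h1.trans (by simp)

theorem nfs_visited_nodup (G : SimpleGraph V) : (nfs G).visited.Nodup :=
  (isSound_stateAt G (Fintype.card V)).visited_nodup

theorem mem_nfs_visited (G : SimpleGraph V) (v : V) : v ∈ (nfs G).visited := by
  have h := List.toFinset_card_of_nodup (nfs_visited_nodup G)
  rw [nfs_visited_length, Finset.card_eq_iff_eq_univ] at h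
  rw [← List.mem_toFinset, h]
  exact Finset.mem_univ v

theorem enterComponent_visited_prefix (s : NFSState V) :
    s.visited <+: (enterComponent s).visited := by
  rcases enterComponent_cases s with h | ⟨m, -, -, h⟩ <;> rw [h]
  exact List.prefix_append _ _

theorem enterComponent_tree (s : NFSState V) : (enterComponent s).tree = s.tree := by
  rcases enterComponent_cases s with h | ⟨m, -, -, h⟩ <;> rw [h]

theorem enterComponent_visited_prefix_succ (G : SimpleGraph V) (k : ℕ) :
    (enterComponent (stateAt G k)).visited <+: (enterComponent (stateAt G (k + 1))).visited := by
  rw [stateAt_succ]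
  rcases h : (enterComponent (stateAt G k)).pending with _ | ⟨v, rest⟩
  · rw [nfsStep_eq_self h]
  · rw [nfsStep_eq_activate h]
    exact (List.prefix_append _ (unvisitedNeighbors G _ v)).trans
      (enterComponent_visited_prefix (activate G _ v rest))

theorem enterComponent_visited_mono (G : SimpleGraph V) {k l : ℕ} (h : k ≤ l) :
    (enterComponent (stateAt G k)).visited <+: (enterComponent (stateAt G l)).visited := by
  induction l, h using Nat.le_induction with
  | base => exact List.prefix_rfl
  | succ l _ ih => exact ih.trans (enterComponent_visited_prefix_succ G l)

theorem enterComponent_of_complete {s : NFSState V} (hs : ∀ v, v ∈ s.visited) :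
    enterComponent s = s := by
  rcases enterComponent_cases s with h | ⟨m, hm, -, -⟩
  · exact h
  · exact absurd (hs m) hm

theorem enterComponent_nfs (G : SimpleGraph V) : enterComponent (nfs G) = nfs G :=
  enterComponent_of_complete (mem_nfs_visited G)

theorem visited_prefix_nfs (G : SimpleGraph V) {k : ℕ} (h : k ≤ Fintype.card V) :
    (enterComponent (stateAt G k)).visited <+: (nfs G).visited := by
  have := enterComponent_visited_mono G h
  rwa [show stateAt G (Fintype.card V) = nfs G from rfl, enterComponent_nfs] at this

theorem tree_prefix_succ (G : SimpleGraph V) (k : ℕ) :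
    (stateAt G k).tree <+: (stateAt G (k + 1)).tree := by
  rw [stateAt_succ]
  rcases h : (enterComponent (stateAt G k)).pending with _ | ⟨v, rest⟩
  · rw [nfsStep_eq_self h]
  · rw [nfsStep_eq_activate h]
    simp only [activate, enterComponent_tree]
    exact List.prefix_append _ _

theorem tree_mono (G : SimpleGraph V) {k l : ℕ} (h : k ≤ l) :
    (stateAt G k).tree <+: (stateAt G l).tree := by
  induction l, h using Nat.le_induction with
  | base => exact List.prefix_rfl
  | succ l _ ih => exact ih.trans (tree_prefix_succ G l)

theorem stateAt_of_card_le (G : SimpleGraph V) {k : ℕ} (h : Fintype.card V ≤ k) :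
    stateAt G k = nfs G := by
  induction k, h using Nat.le_induction with
  | base => rfl
  | succ k _ ih =>
    rw [stateAt_succ, ih]
    exact nfsStep_eq_self (by rw [enterComponent_nfs, nfs_pending])

/-! ### Activation steps and canes -/

theorem lt_card_of_active {G : SimpleGraph V} {k : ℕ} {v : V} {rest : List V}
    (h : (enterComponent (stateAt G k)).pending = v :: rest) : k < Fintype.card V := by
  by_contra! hk
  rw [stateAt_of_card_le G hk, enterComponent_nfs, nfs_pending] at h
  cases h

/-- `IsActive G k v rest`: in step `k` of the search on `G`, the node `v` becomes active, the other
pending nodes being those in `rest`. -/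
def IsActive (G : SimpleGraph V) (k : ℕ) (v : V) (rest : List V) : Prop :=
  (enterComponent (stateAt G k)).pending = v :: rest

/-- The nodes visited when step `k` activates a node. -/
def visitedAt (G : SimpleGraph V) (k : ℕ) : List V := (enterComponent (stateAt G k)).visited

theorem isSound_enterComponent (G : SimpleGraph V) (k : ℕ) :
    IsSound G (enterComponent (stateAt G k)) :=
  (reached_stateAt G k).enterComponent.isSound

theorem mem_visitedAt_mono {G : SimpleGraph V} {k l : ℕ} (h : k ≤ l) {v : V}
    (hv : v ∈ visitedAt G k) : v ∈ visitedAt G l :=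
  (enterComponent_visited_mono G h).subset hv

theorem IsActive.mem_visitedAt {G : SimpleGraph V} {k : ℕ} {v : V} {rest : List V}
    (h : IsActive G k v rest) : v ∈ visitedAt G k :=
  (isSound_enterComponent G k).pending_sub v (by rw [h]; simp)

theorem IsActive.rest_subset {G : SimpleGraph V} {k : ℕ} {v w : V} {rest : List V}
    (h : IsActive G k v rest) (hw : w ∈ rest) : w ∈ visitedAt G k :=
  (isSound_enterComponent G k).pending_sub w (by rw [h]; simp [hw])

theorem IsActive.nodup {G : SimpleGraph V} {k : ℕ} {v : V} {rest : List V}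
    (h : IsActive G k v rest) : (v :: rest).Nodup := by
  have := (isSound_enterComponent G k).pending_nodup
  rwa [h] at this

theorem IsActive.stateAt_succ {G : SimpleGraph V} {k : ℕ} {v : V} {rest : List V}
    (h : IsActive G k v rest) :
    stateAt G (k + 1) = activate G (TGayley.enterComponent (stateAt G k)) v rest := by
  rw [TGayley.stateAt_succ, nfsStep_eq_activate h]

/-- Only unvisited nodes are pushed, so a node that has left the pending list never returns. -/
theorem not_mem_pending_succ {G : SimpleGraph V} {k : ℕ} {v : V} (hv : v ∈ visitedAt G k)
    (hp : v ∉ (enterComponent (stateAt G k)).pending) :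
    v ∉ (enterComponent (stateAt G (k + 1))).pending := by
  rcases h : (enterComponent (stateAt G k)).pending with _ | ⟨a, rest⟩
  · rwa [stateAt_succ, nfsStep_eq_self h]
  · have hact : IsActive G k a rest := h
    rw [h] at hp
    rw [hact.stateAt_succ]
    have h1 : v ∉ (activate G (enterComponent (stateAt G k)) a rest).pending := by
      simp only [activate, List.mem_append, List.mem_reverse, mem_unvisitedNeighbors, not_or]
      exact ⟨fun h => h.2 hv, fun h => hp (List.mem_cons_of_mem _ h)⟩
    rcases enterComponent_cases (activate G (enterComponent (stateAt G k)) a rest)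
      with h' | ⟨m, hm, -, h'⟩ <;> rw [h']
    · exact h1
    · rw [List.mem_singleton]
      rintro rfl
      refine hm ?_
      simp only [activate, List.mem_append]
      exact Or.inl hv

theorem IsActive.not_mem_pending {G : SimpleGraph V} {k l : ℕ} {v : V} {rest : List V}
    (h : IsActive G k v rest) (hkl : k < l) : v ∉ (TGayley.enterComponent (stateAt G l)).pending := by
  induction l, hkl using Nat.le_induction with
  | base =>
    rw [h.stateAt_succ]
    have h1 : v ∉ (activate G (TGayley.enterComponent (stateAt G k)) v rest).pending := by
      simp only [activate, List.mem_append, List.mem_reverse, mem_unvisitedNeighbors, not_or]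
      exact ⟨fun h' => h'.2 h.mem_visitedAt, (List.nodup_cons.1 h.nodup).1⟩
    rcases enterComponent_cases (activate G (TGayley.enterComponent (stateAt G k)) v rest)
      with h' | ⟨m, hm, -, h'⟩ <;> rw [h']
    · exact h1
    · rw [List.mem_singleton]
      rintro rfl
      refine hm ?_
      simp only [activate, List.mem_append]
      exact Or.inl h.mem_visitedAt
  | succ l hl ih =>
    exact not_mem_pending_succ (mem_visitedAt_mono (by omega) h.mem_visitedAt) ih

theorem IsActive.unique {G : SimpleGraph V} {k l : ℕ} {v : V} {r r' : List V}
    (h : IsActive G k v r) (h' : IsActive G l v r') : k = l ∧ r = r' := by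
  rcases lt_trichotomy k l with hkl | rfl | hkl
  · exact absurd (by rw [h']; simp) (h.not_mem_pending hkl)
  · exact ⟨rfl, (List.cons.inj (h.symm.trans h')).2⟩
  · exact absurd (by rw [h]; simp) (h'.not_mem_pending hkl)

/-- A visited node leaves the pending list only by becoming active, and at the end the list is
empty. -/
theorem exists_isActive (G : SimpleGraph V) (v : V) : ∃ k rest, IsActive G k v rest := by
  have key : ∀ k, v ∈ (enterComponent (stateAt G k)).visited →
      v ∈ (enterComponent (stateAt G k)).pending ∨ ∃ l rest, IsActive G l v rest := by
    intro k
    induction k with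
    | zero =>
      intro hv
      rcases enterComponent_cases (stateAt G 0) with h' | ⟨m, hm, -, h'⟩ <;> rw [h'] at hv ⊢
      · simp [stateAt_zero] at hv
      · simpa [stateAt_zero] using Or.inl hv
    | succ k ih =>
      intro hv
      rcases h : (enterComponent (stateAt G k)).pending with _ | ⟨a, rest⟩
      · rw [stateAt_succ, nfsStep_eq_self h] at hv ⊢
        exact ih hv
      · have hact : IsActive G k a rest := h
        by_cases hva : v = a
        · exact Or.inr ⟨k, rest, hva ▸ hact⟩
        have h1 : v ∈ (stateAt G (k + 1)).visited →
            v ∈ (stateAt G (k + 1)).pending ∨ ∃ l rest, IsActive G l v rest := by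
          rw [hact.stateAt_succ]
          simp only [activate, List.mem_append, List.mem_reverse]
          rintro (h2 | h2)
          · rcases ih h2 with h3 | h3
            · rw [h] at h3
              simp [hva] at h3
              exact Or.inl (Or.inr h3)
            · exact Or.inr h3
          · exact Or.inl (Or.inl h2)
        rcases enterComponent_cases (stateAt G (k + 1)) with h' | ⟨m, hm, hp, h'⟩ <;> rw [h'] at hv ⊢
        · exact h1 hv
        · simp only [List.mem_append, List.mem_singleton] at hv ⊢
          rcases hv with hv | hv
          · rcases h1 hv with h2 | h2
            · rw [hp] at h2
              cases h2
            · exact Or.inr h2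
          · exact Or.inl hv
  rcases key (Fintype.card V) (by
    rw [show stateAt G (Fintype.card V) = nfs G from rfl, enterComponent_nfs]
    exact mem_nfs_visited G v) with h | h
  · rw [show stateAt G (Fintype.card V) = nfs G from rfl, enterComponent_nfs, nfs_pending] at h
    cases h
  · exact h

/-- Edges leaving `v` are recorded only when `v` becomes active, which happens in one step only. -/
theorem IsActive.mem_tree_iff {G : SimpleGraph V} {k : ℕ} {v w : V} {rest : List V}
    (h : IsActive G k v rest) : (v, w) ∈ (nfs G).tree ↔ G.Adj v w ∧ w ∉ visitedAt G k := by
  constructor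
  · intro hvw
    have key : ∀ l, (v, w) ∈ (stateAt G l).tree → ∃ i r, IsActive G i v r ∧
        G.Adj v w ∧ w ∉ visitedAt G i := by
      intro l
      induction l with
      | zero => simp [stateAt_zero]
      | succ l ih =>
        intro hl
        rcases h : (enterComponent (stateAt G l)).pending with _ | ⟨a, r⟩
        · rw [TGayley.stateAt_succ, nfsStep_eq_self h] at hl
          exact ih hl
        · have hact : IsActive G l a r := h
          rw [hact.stateAt_succ] at hl
          simp only [activate, enterComponent_tree, List.mem_append, List.mem_map,
            mem_unvisitedNeighbors, Prod.mk.injEq] at hl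
          rcases hl with hl | ⟨b, hb, rfl, rfl⟩
          · exact ih hl
          · exact ⟨l, r, hact, hb⟩
    obtain ⟨i, r, hi, hw⟩ := key _ hvw
    obtain ⟨rfl, rfl⟩ := h.unique hi
    exact hw
  · intro hw
    have h1 : (v, w) ∈ (stateAt G (k + 1)).tree := by
      rw [h.stateAt_succ]
      simp only [activate, List.mem_append, List.mem_map, Prod.mk.injEq]
      exact Or.inr ⟨w, mem_unvisitedNeighbors.2 hw, by simp, rfl⟩
    exact (tree_mono G (lt_card_of_active h)).subset h1

/-- The pair `(v, w)` is a cane of the search on `G`: `w` is visited and has not yet been active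
when `v` becomes active. -/
def IsCane (G : SimpleGraph V) (v w : V) : Prop := ∃ k rest, IsActive G k v rest ∧ w ∈ rest

theorem IsCane.lt {G : SimpleGraph V} {v w : V} (h : IsCane G v w) {k l : ℕ} {r r' : List V}
    (hv : IsActive G k v r) (hw : IsActive G l w r') : k < l := by
  obtain ⟨i, s, hi, hws⟩ := h
  obtain ⟨rfl, rfl⟩ := hv.unique hi
  by_contra! hlk
  rcases hlk.lt_or_eq with hlk | rfl
  · exact hw.not_mem_pending hlk (by rw [hv]; simp [hws])
  · have := hv.symm.trans hw
    obtain ⟨rfl, -⟩ := List.cons.inj this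
    exact (List.nodup_cons.1 hv.nodup).1 hws

theorem IsCane.asymm {G : SimpleGraph V} {v w : V} (h : IsCane G v w) : ¬ IsCane G w v := by
  intro h'
  obtain ⟨k, r, hk⟩ := exists_isActive G v
  obtain ⟨l, r', hl⟩ := exists_isActive G w
  exact lt_asymm (h.lt hk hl) (h'.lt hl hk)

theorem IsCane.ne {G : SimpleGraph V} {v w : V} (h : IsCane G v w) : v ≠ w := by
  rintro rfl
  exact h.asymm h

theorem lt_of_mem_tree {G : SimpleGraph V} {v w : V} (h : (v, w) ∈ (nfs G).tree) {k l : ℕ}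
    {r r' : List V} (hv : IsActive G k v r) (hw : IsActive G l w r') : k < l := by
  by_contra! hlk
  exact (hv.mem_tree_iff.1 h).2 (mem_visitedAt_mono hlk hw.mem_visitedAt)

theorem IsCane.not_mem_tree {G : SimpleGraph V} {v w : V} (h : IsCane G v w) :
    (v, w) ∉ (nfs G).tree ∧ (w, v) ∉ (nfs G).tree := by
  obtain ⟨k, r, hk⟩ := exists_isActive G v
  obtain ⟨l, r', hl⟩ := exists_isActive G w
  constructor
  · intro ht
    obtain ⟨i, s, hi, hws⟩ := h
    exact (hi.mem_tree_iff.1 ht).2 (hi.rest_subset hws)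
  · intro ht
    exact lt_asymm (h.lt hk hl) (lt_of_mem_tree ht hl hk)

/-- Consider the end that becomes active first. If the other end is unvisited then, the edge enters
the search forest; if it is visited, it must still be pending, since its activation is yet to come.
-/
theorem tree_or_isCane_of_adj {G : SimpleGraph V} {v w : V} (h : G.Adj v w) :
    (v, w) ∈ (nfs G).tree ∨ (w, v) ∈ (nfs G).tree ∨ IsCane G v w ∨ IsCane G w v := by
  have key : ∀ {v w : V}, G.Adj v w → ∀ {k l : ℕ} {r r' : List V}, IsActive G k v r →
      IsActive G l w r' → k < l → (v, w) ∈ (nfs G).tree ∨ IsCane G v w := by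
    intro v w h k l r r' hk hl hkl
    by_cases hw : w ∈ visitedAt G k
    · right
      refine ⟨k, r, hk, ?_⟩
      by_contra hwr
      have hw' : w ∉ (enterComponent (stateAt G k)).pending := by
        rw [hk]
        simp [hwr, h.ne.symm]
      have : ∀ i, k ≤ i → w ∉ (enterComponent (stateAt G i)).pending := by
        intro i hi
        induction i, hi using Nat.le_induction with
        | base => exact hw'
        | succ i hi ih => exact not_mem_pending_succ (mem_visitedAt_mono hi hw) ih
      exact this l hkl.le (by rw [hl]; simp)
    · exact Or.inl (hk.mem_tree_iff.2 ⟨h, hw⟩)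
  obtain ⟨k, r, hk⟩ := exists_isActive G v
  obtain ⟨l, r', hl⟩ := exists_isActive G w
  rcases lt_trichotomy k l with hkl | rfl | hkl
  · rcases key h hk hl hkl with h | h <;> simp [h]
  · exact absurd (List.cons.inj (hk.symm.trans hl)).1 h.ne
  · rcases key h.symm hl hk hkl with h | h <;> simp [h]

/-- The searches on `G` and on `G'` run in the same way if `G'` contains the search forest of `G`
and its other edges are canes of the search on `G`. -/
theorem stateAt_eq_of_tree_of_isCane {G G' : SimpleGraph V}
    (h1 : ∀ v w, (v, w) ∈ (nfs G).tree → G'.Adj v w)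
    (h2 : ∀ v w, G'.Adj v w →
      (v, w) ∈ (nfs G).tree ∨ (w, v) ∈ (nfs G).tree ∨ IsCane G v w ∨ IsCane G w v) (k : ℕ) :
    stateAt G' k = stateAt G k := by
  induction k with
  | zero => rfl
  | succ k ih =>
    rcases h : (enterComponent (stateAt G k)).pending with _ | ⟨v, rest⟩
    · rw [stateAt_succ, stateAt_succ, ih, nfsStep_eq_self h, nfsStep_eq_self h]
    · have hact : IsActive G k v rest := h
      have hact' : IsActive G' k v rest := by rw [IsActive, ih]; exact h
      rw [hact.stateAt_succ, hact'.stateAt_succ, ih]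
      -- When either end of a cane becomes active, the other end has already been visited; so canes
      -- contribute no unvisited neighbors.
      have : unvisitedNeighbors G' (enterComponent (stateAt G k)).visited v =
          unvisitedNeighbors G (enterComponent (stateAt G k)).visited v := by
        unfold unvisitedNeighbors
        congr 1
        ext w
        simp only [Finset.mem_filter, Finset.mem_univ, true_and, and_congr_left_iff]
        intro hw
        constructor
        · intro hvw
          rcases h2 v w hvw with h | h | h | h
          · exact (hact.mem_tree_iff.1 h).1
          · exact ((isSound_stateAt G (Fintype.card V)).tree_mem w v h).2.2.symm
          · obtain ⟨l, r, hl, hwr⟩ := h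
            obtain ⟨rfl, rfl⟩ := hact.unique hl
            exact absurd (hact.rest_subset hwr) hw
          · obtain ⟨l, r, hl⟩ := exists_isActive G w
            have hlk := h.lt hl hact
            exact absurd (mem_visitedAt_mono hlk.le hl.mem_visitedAt) hw
        · intro hvw
          exact h1 v w (hact.mem_tree_iff.2 ⟨hvw, hw⟩)
      unfold activate
      rw [this]

/-! ### The search forest and its canes -/

theorem phi_adj {G : SimpleGraph V} {v w : V} :
    (Phi G).Adj v w ↔ (v, w) ∈ (nfs G).tree ∨ (w, v) ∈ (nfs G).tree := by
  unfold Phi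
  rw [SimpleGraph.fromRel_adj]
  constructor
  · exact fun h => h.2
  · intro h
    refine ⟨?_, h⟩
    rintro rfl
    have := ((isSound_stateAt G (Fintype.card V)).tree_mem v v ((or_self_iff).1 h)).2.2
    exact this.ne rfl

theorem phi_le (G : SimpleGraph V) : Phi G ≤ G := by
  intro v w h
  rcases phi_adj.1 h with h | h
  · exact ((isSound_stateAt G (Fintype.card V)).tree_mem v w h).2.2
  · exact ((isSound_stateAt G (Fintype.card V)).tree_mem w v h).2.2.symm

/-- The graph formed by the canes of the search on `G`. -/
def caneGraph (G : SimpleGraph V) : SimpleGraph V := SimpleGraph.fromRel (IsCane G)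

theorem caneGraph_adj {G : SimpleGraph V} {v w : V} :
    (caneGraph G).Adj v w ↔ IsCane G v w ∨ IsCane G w v := by
  unfold caneGraph
  rw [SimpleGraph.fromRel_adj]
  exact ⟨fun h => h.2, fun h => ⟨h.elim IsCane.ne fun h => h.ne.symm, h⟩⟩

theorem disjoint_phi_caneGraph (G : SimpleGraph V) : Disjoint (Phi G) (caneGraph G) := by
  rw [SimpleGraph.disjoint_left]
  intro v w h h'
  rw [phi_adj] at h
  rw [caneGraph_adj] at h'
  rcases h' with h' | h' <;> have := h'.not_mem_tree <;> tauto

theorem le_phi_sup_caneGraph (G : SimpleGraph V) : G ≤ Phi G ⊔ caneGraph G := by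
  intro v w h
  rw [SimpleGraph.sup_adj, phi_adj, caneGraph_adj]
  have := tree_or_isCane_of_adj h
  tauto

theorem stateAt_eq_of_le_of_le {G G' : SimpleGraph V} (h1 : Phi G ≤ G')
    (h2 : G' ≤ Phi G ⊔ caneGraph G) (k : ℕ) : stateAt G' k = stateAt G k := by
  refine stateAt_eq_of_tree_of_isCane (fun v w h => h1 (phi_adj.2 (Or.inl h))) (fun v w h => ?_) k
  have := h2 h
  rw [SimpleGraph.sup_adj, phi_adj, caneGraph_adj] at this
  tauto

theorem phi_eq_of_stateAt_eq {G G' : SimpleGraph V} (h : ∀ k, stateAt G' k = stateAt G k) :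
    Phi G' = Phi G := by
  unfold Phi
  rw [show nfs G' = nfs G from h _]

theorem caneGraph_eq_of_stateAt_eq {G G' : SimpleGraph V} (h : ∀ k, stateAt G' k = stateAt G k) :
    caneGraph G' = caneGraph G := by
  have : IsCane G' = IsCane G := by
    unfold IsCane IsActive
    simp only [h]
  unfold caneGraph
  rw [this]

/-- Deleting all canes does not affect the search, so the canes of `G` can be read off from `Phi G`
alone. -/
theorem stateAt_phi (G : SimpleGraph V) (k : ℕ) : stateAt (Phi G) k = stateAt G k :=
  stateAt_eq_of_le_of_le le_rfl le_sup_left k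

/-- On a cycle, both neighbors of the node visited last would be its parents in the search forest,
but a node is visited along only one edge. -/
theorem phi_isAcyclic (G : SimpleGraph V) : (Phi G).IsAcyclic := by
  have hs := isSound_stateAt G (Fintype.card V)
  intro v c hc
  obtain ⟨m, hm, hmax⟩ := Finset.exists_max_image c.support.toFinset
    (fun u => (nfs G).visited.idxOf u) ⟨v, by simp⟩
  rw [List.mem_toFinset] at hm
  have hc' := hc.rotate hm
  have hpar : ∀ u ∈ c.support, (Phi G).Adj m u → (u, m) ∈ (nfs G).tree := by
    intro u hu hmu
    rcases phi_adj.1 hmu with h | h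
    · exact absurd (hs.tree_lt m u h) (not_lt.2 (hmax u (by simpa using hu)))
    · exact h
  have hmem : ∀ u ∈ (c.rotate m hm).support, u ∈ c.support := fun u hu =>
    (SimpleGraph.Walk.mem_support_rotate_iff c m hm).1 hu
  refine hc'.snd_ne_penultimate (hs.tree_unique _ _ m (hpar _ (hmem _ ?_) ?_) (hpar _ (hmem _ ?_) ?_))
  · exact SimpleGraph.Walk.getVert_mem_support _ _
  · exact SimpleGraph.Walk.adj_snd hc'.not_nil
  · exact SimpleGraph.Walk.getVert_mem_support _ _
  · exact (SimpleGraph.Walk.adj_penultimate hc'.not_nil).symm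

end Run

/-! ### Parents, roots and cane paths in forests -/

/-- In the list of children of a node, this turns an index into the number of larger siblings. -/
theorem card_filter_lt_getElem {V : Type*} [LinearOrder V] {C : List V} (hC : C.Pairwise (· > ·)) {i : ℕ} {c : V}
    (hc : C[i]? = some c) : (C.toFinset.filter fun w => c < w).card = i := by
  obtain ⟨hi, rfl⟩ := List.getElem?_eq_some_iff.1 hc
  have hnd : C.Nodup := hC.imp fun h => ne_of_gt h
  have : (C.toFinset.filter fun w => C[i] < w) = (C.take i).toFinset := by
    ext w
    simp only [Finset.mem_filter, List.mem_toFinset, List.mem_take_iff_getElem]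
    rw [List.pairwise_iff_getElem] at hC
    constructor
    · rintro ⟨hw, hlt⟩
      obtain ⟨j, hj, rfl⟩ := List.getElem_of_mem hw
      refine ⟨j, ?_, rfl⟩
      by_contra! hji
      rcases (show i ≤ j by omega).lt_or_eq with h | rfl
      · exact lt_asymm hlt (hC i j hi hj h)
      · exact lt_irrefl _ hlt
    · rintro ⟨j, hj, rfl⟩
      exact ⟨List.getElem_mem _, hC j i (by omega) hi (by omega)⟩
  rw [this, List.toFinset_card_of_nodup (hnd.sublist (List.take_sublist _ _)), List.length_take]
  omega

section Forest

variable {V : Type*} [Fintype V] [LinearOrder V]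

theorem root_reachable (F : SimpleGraph V) (v : V) : F.Reachable v (root F v) := by
  classical
  have := Finset.max'_mem (Finset.univ.filter (fun w => F.Reachable v w))
    ⟨v, Finset.mem_filter.2 ⟨Finset.mem_univ v, SimpleGraph.Reachable.refl v⟩⟩
  unfold root
  convert (Finset.mem_filter.1 this).2

theorem le_root_of_reachable {F : SimpleGraph V} {v w : V} (h : F.Reachable v w) :
    w ≤ root F v := by
  classical
  unfold root
  exact Finset.le_max' _ _ (by simpa using h)

theorem le_root (F : SimpleGraph V) (v : V) : v ≤ root F v :=
  le_root_of_reachable (SimpleGraph.Reachable.refl v)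

theorem root_eq_of_reachable {F : SimpleGraph V} {v w : V} (h : F.Reachable v w) :
    root F v = root F w :=
  le_antisymm (le_root_of_reachable (h.symm.trans (root_reachable F v)))
    (le_root_of_reachable (h.trans (root_reachable F w)))

theorem root_root (F : SimpleGraph V) (v : V) : root F (root F v) = root F v :=
  (root_eq_of_reachable (root_reachable F v)).symm

theorem IsParent.root_eq {F : SimpleGraph V} {p v : V} (h : IsParent F p v) :
    root F v = root F p :=
  root_eq_of_reachable h.1.reachable

theorem IsParent.ne_root {F : SimpleGraph V} {p v : V} (h : IsParent F p v) : v ≠ root F v := by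
  intro hv
  have := h.2
  rw [← hv, SimpleGraph.dist_self] at this
  omega

theorem isParent_or_isParent {F : SimpleGraph V} (hF : F.IsAcyclic) {v w : V} (h : F.Adj v w) :
    IsParent F v w ∨ IsParent F w v := by
  have hr := root_eq_of_reachable h.reachable
  have := hF.dist_eq_dist_add_one_of_adj_of_reachable (root F v) h (root_reachable F v).symm
  rw [SimpleGraph.dist_comm, SimpleGraph.dist_comm (v := w)] at this
  rcases this with h' | h'
  · exact Or.inr ⟨h, h'⟩
  · exact Or.inl ⟨h.symm, hr ▸ h'⟩

/-- Each parent is the second node of a shortest path to the root, and an acyclic graph has only one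
path between two nodes. -/
theorem IsParent.unique {F : SimpleGraph V} (hF : F.IsAcyclic) {p q v : V} (hp : IsParent F p v)
    (hq : IsParent F q v) : p = q := by
  have key : ∀ {p : V}, IsParent F p v → ∃ P : F.Path v (root F v), P.1.snd = p := by
    intro p hp
    have hreach : F.Reachable p (root F v) := hp.1.symm.reachable.trans (root_reachable F v)
    obtain ⟨W, hW⟩ := hreach.exists_walk_length_eq_dist
    have hlen : (SimpleGraph.Walk.cons hp.1 W).length = F.dist v (root F v) := by
      rw [SimpleGraph.Walk.length_cons, hW, hp.2]
    exact ⟨⟨_, SimpleGraph.Walk.isPath_of_length_eq_dist _ hlen⟩, by simp⟩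
  obtain ⟨P, hP⟩ := key hp
  obtain ⟨Q, hQ⟩ := key hq
  rw [← hP, ← hQ, (hF.subsingleton_path v (root F v)).elim P Q]

theorem exists_isParent {F : SimpleGraph V} {v : V} (hv : v ≠ root F v) :
    ∃ p, IsParent F p v := by
  obtain ⟨W, hW⟩ := (root_reachable F v).exists_walk_length_eq_dist
  have hnil : ¬ W.Nil := SimpleGraph.Walk.not_nil_of_ne hv
  refine ⟨W.snd, W.adj_snd hnil, ?_⟩
  have h1 := SimpleGraph.dist_le W.tail
  have h2 := SimpleGraph.Walk.length_tail_add_one hnil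
  obtain ⟨W', hW'⟩ := W.tail.reachable.exists_walk_length_eq_dist
  have h3 := SimpleGraph.dist_le (SimpleGraph.Walk.cons (W.adj_snd hnil) W')
  rw [SimpleGraph.Walk.length_cons, hW'] at h3
  omega

/-! ### Counting cane paths -/

theorem IsCanePath.three_le_length {F : SimpleGraph V} {l : List V} (h : IsCanePath F l) :
    3 ≤ l.length := by
  induction h with
  | bend => simp
  | up _ _ ih => simp at ih ⊢; omega

theorem numCanePaths_of_eq_root {F : SimpleGraph V} {v : V} (hv : root F v = v) :
    numCanePaths F v = 0 := by
  have : {l : List V | IsCanePath F l ∧ l.head? = some v} = ∅ := by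
    rw [Set.eq_empty_iff_forall_notMem]
    rintro l ⟨h, hl⟩
    cases h with
    | bend hu hw huw =>
      simp at hl; subst hl; exact hu.ne_root hv.symm
    | up hu h =>
      simp at hl; subst hl; exact hu.ne_root hv.symm
  unfold numCanePaths
  rw [this, Set.ncard_empty]

/-- The first step can only go to the parent `p`. There the path either turns down to a larger
sibling of `v` or goes on as a cane path starting in `p`. -/
theorem setOf_isCanePath_eq {F : SimpleGraph V} (hF : F.IsAcyclic) {p v : V}
    (hp : IsParent F p v) :
    {l : List V | IsCanePath F l ∧ l.head? = some v} =
      (fun w => [v, p, w]) '' {w | IsParent F p w ∧ v < w} ∪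
        (v :: ·) '' {l : List V | IsCanePath F l ∧ l.head? = some p} := by
  ext l
  simp only [Set.mem_ofPred_eq, Set.mem_union, Set.mem_image]
  constructor
  · rintro ⟨h, hl⟩
    cases h with
    | @bend u q w hu hw huw =>
      simp at hl
      subst hl
      obtain rfl := hp.unique hF hu
      exact Or.inl ⟨w, ⟨hw, huw⟩, rfl⟩
    | @up u q l hu h =>
      simp at hl
      subst hl
      obtain rfl := hp.unique hF hu
      exact Or.inr ⟨_, ⟨h, rfl⟩, rfl⟩
  · rintro (⟨w, ⟨hw, hvw⟩, rfl⟩ | ⟨l', ⟨h, hl⟩, rfl⟩)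
    · exact ⟨IsCanePath.bend hp hw hvw, rfl⟩
    · cases l' with
      | nil => simp at hl
      | cons a l' =>
        simp at hl
        subst hl
        exact ⟨IsCanePath.up hp h, rfl⟩

theorem finite_setOf_isCanePath {F : SimpleGraph V} (hF : F.IsAcyclic) (v : V) :
    {l : List V | IsCanePath F l ∧ l.head? = some v}.Finite := by
  induction h : F.dist v (root F v) generalizing v with
  | zero =>
    have hv : v = root F v := ((root_reachable F v).dist_eq_zero_iff).1 h
    refine Set.Finite.subset Set.finite_empty ?_
    rintro l ⟨h, hl⟩
    cases h with
    | bend hu hw huw =>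
      simp at hl; subst hl; exact hu.ne_root hv
    | up hu h =>
      simp at hl; subst hl; exact hu.ne_root hv
  | succ d ih =>
    have hv : v ≠ root F v := by
      intro hv
      rw [← hv, SimpleGraph.dist_self] at h
      omega
    obtain ⟨p, hp⟩ := exists_isParent hv
    rw [setOf_isCanePath_eq hF hp]
    refine Set.Finite.union ((Set.toFinite _).image _) ((ih p ?_).image _)
    have := hp.2
    rw [← hp.root_eq]
    omega

-- The pending list satisfies the same recursion: when the children of `p` are pushed, the nodes
-- behind `v` are its larger siblings and the nodes that were behind `p`.
open Classical in
theorem numCanePaths_of_isParent {F : SimpleGraph V} (hF : F.IsAcyclic) {p v : V}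
    (hp : IsParent F p v) :
    numCanePaths F v =
      numCanePaths F p + (Finset.univ.filter fun w => IsParent F p w ∧ v < w).card := by
  unfold numCanePaths
  rw [setOf_isCanePath_eq hF hp, Set.ncard_union_eq ?_ ((Set.toFinite _).image _)
    ((finite_setOf_isCanePath hF p).image _)]
  · rw [Set.ncard_image_of_injective _ (List.cons_injective), add_comm,
      Set.ncard_image_of_injective, ← Set.ncard_coe_finset]
    · simp
    · intro a b h
      simpa using h
  · rw [Set.disjoint_left]
    rintro _ ⟨w, -, rfl⟩ ⟨l, ⟨hl, -⟩, h⟩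
    have := hl.three_le_length
    rw [(List.cons.inj h).2] at this
    simp at this

/-! ### The search on a forest -/

/-- Every node of the list starts as many cane paths as there are nodes behind it. -/
def IsStack (F : SimpleGraph V) (L : List V) : Prop :=
  ∀ i v, L[i]? = some v → numCanePaths F v + i + 1 = L.length

theorem isStack_nil (F : SimpleGraph V) : IsStack F [] := by
  intro i v h
  simp at h

theorem IsStack.tail {F : SimpleGraph V} {v : V} {L : List V} (h : IsStack F (v :: L)) :
    IsStack F L := by
  intro i w hw
  have := h (i + 1) w (by simpa using hw)
  simp at this
  omega

theorem IsStack.head {F : SimpleGraph V} {v : V} {L : List V} (h : IsStack F (v :: L)) :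
    numCanePaths F v = L.length := by
  have := h 0 v (by simp)
  simpa using this

theorem IsStack.push {F : SimpleGraph V} {C L : List V} (h : IsStack F L)
    (hC : ∀ i c, C[i]? = some c → numCanePaths F c = L.length + i) :
    IsStack F (C.reverse ++ L) := by
  intro i v hv
  rcases lt_or_ge i C.length with hi | hi
  · rw [List.getElem?_append_left (by simpa using hi), List.getElem?_reverse hi] at hv
    have := hC _ _ hv
    simp
    omega
  · rw [List.getElem?_append_right (by simpa using hi)] at hv
    have := h _ _ hv
    simp at this ⊢
    omega

theorem IsStack.of_push {F : SimpleGraph V} {C L : List V} (h : IsStack F (C.reverse ++ L)) {i : ℕ}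
    {c : V} (hc : C[i]? = some c) : numCanePaths F c = L.length + i := by
  have hi : i < C.length := (List.getElem?_eq_some_iff.1 hc).1
  have := h (C.length - 1 - i) c (by
    rw [List.getElem?_append_left (by simp; omega), List.getElem?_reverse (by omega)]
    rw [← hc]
    congr 1
    omega)
  simp at this
  omega

/-- The relation between nodes `u` and `v` of the forest `F` that are visited in succession. -/
def Follows (F : SimpleGraph V) (u v : V) : Prop :=
  (root F v = v ∧ v < root F u) ∨
    (root F v ≠ v ∧ root F v = root F u ∧ (numCanePaths F v ≤ numCanePaths F u ∨
      (numCanePaths F v = numCanePaths F u + 1 ∧ v < u ∧ root F u ≠ u)))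

/-- The properties of a state of the search on a forest. -/
structure IsForestState (F : SimpleGraph V) (s : NFSState V) : Prop where
  root_mem : ∀ u ∈ s.visited, root F u ∈ s.visited
  -- The root of `u` was the largest unvisited node when its component was entered.
  lt_root : ∀ u ∈ s.visited, ∀ w, w ∉ s.visited → w < root F u
  pairwise : s.visited.Pairwise (fun u w => w < root F u)
  parent_mem : ∀ u ∈ s.visited, ∀ p, IsParent F p u → p ∈ s.visited ∧ p ∉ s.pending
  stack : IsStack F s.pending
  -- Equality holds just after `u` has been visited and is the head of the pending list; activating
  -- childless nodes then shortens the list.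
  last : ∀ u, s.visited.getLast? = some u →
    s.pending.length ≤ numCanePaths F u + 1 ∧ ∀ v ∈ s.pending, root F v = root F u
  chain : s.visited.IsChain (Follows F)

/-- A visited node can be followed by the root of the next component, by the largest child of the
active node, or by its own next smaller sibling. These cases give the alternatives of `Follows`: the
bound for the largest child comes from `last`, and between successive siblings the number of cane
paths grows by one. -/
theorem Reached.isForestState {F : SimpleGraph V} (hF : F.IsAcyclic) {s : NFSState V}
    (hs : Reached F s) : IsForestState F s := by
  induction hs with
  | init =>
    constructor <;> simp [isStack_nil]
  | @root s m hs hp hm hmax ih =>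
    have hsound := hs.isSound
    -- With nothing pending, the visited set is closed under adjacency, so the component of `m` is
    -- still untouched and `m` is its largest node.
    have hunv : ∀ w, F.Reachable m w → w ∉ s.visited := by
      rintro w ⟨W⟩
      induction W with
      | nil => exact hm
      | @cons a b c hab W ihW =>
        intro hc
        have hback : ∀ {x y : V}, F.Walk x y → x ∈ s.visited → y ∈ s.visited := by
          intro x y W
          induction W with
          | nil => exact id
          | cons h W ih' => exact fun hx => ih' (hsound.closed _ hx (by simp [hp]) _ h)
        exact hm (hback (SimpleGraph.Walk.cons hab W).reverse hc)
    have hmr : TGayley.root F m = m :=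
      le_antisymm (hmax _ (hunv _ (root_reachable F m))) (le_root F m)
    refine ⟨?_, ?_, ?_, ?_, ?_, ?_, ?_⟩ <;> dsimp only
    · intro u hu
      simp only [List.mem_append, List.mem_singleton] at hu ⊢
      rcases hu with hu | rfl
      · exact Or.inl (ih.root_mem u hu)
      · exact Or.inr hmr
    · intro u hu w hw
      simp only [List.mem_append, List.mem_singleton, not_or] at hu hw
      rcases hu with hu | rfl
      · exact ih.lt_root u hu w hw.1
      · rw [hmr]
        exact lt_of_le_of_ne (hmax w hw.1) hw.2
    · rw [List.pairwise_append]
      refine ⟨ih.pairwise, List.pairwise_singleton _ _, fun a ha b hb => ?_⟩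
      rw [List.mem_singleton] at hb
      subst hb
      exact ih.lt_root a ha _ hm
    · intro u hu p hpu
      simp only [List.mem_append, List.mem_singleton] at hu ⊢
      rcases hu with hu | rfl
      · have := (ih.parent_mem u hu p hpu).1
        exact ⟨Or.inl this, fun h => hm (h ▸ this)⟩
      · exact absurd hmr.symm hpu.ne_root
    · intro i v hv
      have : i = 0 ∧ m = v := by
        rcases i with _ | i <;> simp at hv
        simpa using hv
      obtain ⟨rfl, rfl⟩ := this
      simp [numCanePaths_of_eq_root hmr]
    · intro u hu
      simp at hu
      subst hu
      simp
    · rw [List.isChain_append]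
      refine ⟨ih.chain, List.isChain_singleton _, fun a ha b hb => ?_⟩
      simp at hb
      subst hb
      exact Or.inl ⟨hmr, ih.lt_root a (List.mem_of_mem_getLast? ha) _ hm⟩
  | @activate s v rest hs hp ih =>
    have hsound := hs.isSound
    have hv : v ∈ s.visited := hsound.pending_sub v (by simp [hp])
    have hvr : v ∉ rest := by
      have := hsound.pending_nodup
      rw [hp] at this
      exact (List.nodup_cons.1 this).1
    have hrest : ∀ w ∈ rest, w ∈ s.visited := fun w hw => hsound.pending_sub w (by simp [hp, hw])
    have hst := ih.stack
    rw [hp] at hst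
    -- The parent of `v` was visited before `v`, so it is not among the unvisited neighbors; a child
    -- of `v` cannot have been visited while `v` is pending, by `parent_mem`.
    have hchild : ∀ w, w ∈ unvisitedNeighbors F s.visited v ↔ IsParent F v w := by
      intro w
      rw [mem_unvisitedNeighbors]
      constructor
      · rintro ⟨h1, h2⟩
        rcases isParent_or_isParent hF h1 with h | h
        · exact h
        · exact absurd (ih.parent_mem v hv w h).1 h2
      · intro h
        exact ⟨h.1.symm, fun hw => (ih.parent_mem w hw v h).2 (by simp [hp])⟩
    have hnv : ∀ w, IsParent F v w → w ∉ s.visited := fun w hw =>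
      (mem_unvisitedNeighbors.1 ((hchild w).2 hw)).2
    set C := unvisitedNeighbors F s.visited v with hCdef
    have hCp : C.Pairwise (· > ·) := pairwise_unvisitedNeighbors F s.visited v
    have hdepth : ∀ i c, C[i]? = some c → numCanePaths F c = rest.length + i := by
      intro i c hc
      have hcC : c ∈ C := List.mem_of_getElem? hc
      rw [numCanePaths_of_isParent hF ((hchild c).1 hcC), hst.head]
      congr 1
      rw [← card_filter_lt_getElem hCp hc]
      congr 1
      ext w
      simp [hchild]
    have hlastroot : ∀ u, s.visited.getLast? = some u → TGayley.root F u = TGayley.root F v :=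
      fun u hu => ((ih.last u hu).2 v (by simp [hp])).symm
    have hadd : (TGayley.activate F s v rest) =
        ⟨s.visited ++ C, C.reverse ++ rest, s.tree ++ C.map (fun w => (v, w))⟩ := rfl
    rw [hadd]
    refine ⟨?_, ?_, ?_, ?_, ?_, ?_, ?_⟩ <;> dsimp only
    · intro u hu
      simp only [List.mem_append, hchild] at hu ⊢
      rcases hu with hu | hu
      · exact Or.inl (ih.root_mem u hu)
      · rw [hu.root_eq]
        exact Or.inl (ih.root_mem v hv)
    · intro u hu w hw
      simp only [List.mem_append, hchild, not_or] at hu hw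
      rcases hu with hu | hu
      · exact ih.lt_root u hu w hw.1
      · rw [hu.root_eq]
        exact ih.lt_root v hv w hw.1
    · rw [List.pairwise_append]
      refine ⟨ih.pairwise, ?_, fun a ha b hb => ih.lt_root a ha b (hnv b ((hchild b).1 hb))⟩
      rw [List.pairwise_iff_forall_sublist]
      intro a b hab
      have ha : a ∈ C := hab.subset (by simp)
      have hb : b ∈ C := hab.subset (by simp)
      rw [((hchild a).1 ha).root_eq]
      exact ih.lt_root v hv b (hnv b ((hchild b).1 hb))
    · intro u hu p hpu
      simp only [List.mem_append, List.mem_reverse, hchild, not_or] at hu ⊢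
      rcases hu with hu | hu
      · obtain ⟨h1, h2⟩ := ih.parent_mem u hu p hpu
        rw [hp, List.mem_cons, not_or] at h2
        exact ⟨Or.inl h1, fun h => hnv p h h1, h2.2⟩
      · obtain rfl := hpu.unique hF hu
        exact ⟨Or.inl hv, fun h => hnv _ h hv, hvr⟩
    · exact hst.tail.push hdepth
    · intro u hu
      rcases List.eq_nil_or_concat C with hC | ⟨D, c, hC⟩
      · rw [hC] at hu ⊢
        simp only [List.append_nil] at hu
        obtain ⟨h1, h2⟩ := ih.last u hu
        rw [hp] at h1 h2
        simp at h1 h2 ⊢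
        exact ⟨by omega, h2.2⟩
      · rw [hC] at hu
        simp at hu
        subst hu
        have hcC : c ∈ C := by rw [hC]; simp
        have hcd := hdepth D.length c (by rw [hC]; simp)
        have hlen : C.length = D.length + 1 := by rw [hC]; simp
        have hcr := ((hchild c).1 hcC).root_eq
        constructor
        · simp
          omega
        · intro w hw
          simp only [List.mem_append, List.mem_reverse, hchild] at hw
          rcases hw with hw | hw
          · rw [hcr, hw.root_eq]
          · obtain ⟨u, hu⟩ : ∃ u, s.visited.getLast? = some u := by
              rcases h : s.visited.getLast? with _ | u
              · rw [List.getLast?_eq_none_iff] at h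
                rw [h] at hv
                simp at hv
              · exact ⟨u, rfl⟩
            rw [hcr, (ih.last u hu).2 w (by simp [hp, hw]), hlastroot u hu]
    · rw [List.isChain_append]
      refine ⟨ih.chain, ?_, fun a ha b hb => ?_⟩
      · rw [List.isChain_iff_getElem]
        intro i hi
        have h1 := hdepth i _ (List.getElem?_eq_getElem (by omega))
        have h2 := hdepth (i + 1) _ (List.getElem?_eq_getElem hi)
        have p1 := (hchild _).1 (List.getElem_mem (show i < C.length by omega))
        have p2 := (hchild _).1 (List.getElem_mem hi)
        refine Or.inr ⟨p2.ne_root.symm, by rw [p1.root_eq, p2.root_eq], Or.inr ⟨by omega, ?_, p1.ne_root.symm⟩⟩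
        rw [List.pairwise_iff_getElem] at hCp
        exact hCp i (i + 1) (by omega) hi (by omega)
      · have hbC : b ∈ C := List.mem_of_mem_head? hb
        have p := (hchild b).1 hbC
        have hb0 : C[0]? = some b := by rw [← List.head?_eq_getElem?]; exact hb
        have h1 := hdepth 0 b hb0
        have h2 := (ih.last a ha).1
        rw [hp] at h2
        simp at h2
        exact Or.inr ⟨p.ne_root.symm, by rw [p.root_eq, hlastroot a ha], Or.inl (by omega)⟩

theorem isForestState_nfs {F : SimpleGraph V} (hF : F.IsAcyclic) : IsForestState F (nfs F) :=
  (reached_stateAt F (Fintype.card V)).isForestState hF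

/-! ### Fibers of `Phi` and the number of canes -/

theorem IsActive.isParent_iff {F : SimpleGraph V} (hF : F.IsAcyclic) {k : ℕ} {v w : V}
    {rest : List V} (h : IsActive F k v rest) :
    IsParent F v w ↔ F.Adj v w ∧ w ∉ visitedAt F k := by
  have ih := (reached_stateAt F k).enterComponent.isForestState hF
  constructor
  · intro hw
    exact ⟨hw.1.symm, fun h' => (ih.parent_mem w h' v hw).2 (by rw [h]; simp)⟩
  · rintro ⟨h1, h2⟩
    rcases isParent_or_isParent hF h1 with h' | h'
    · exact h'
    · exact absurd (ih.parent_mem v h.mem_visitedAt w h').1 h2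

theorem mem_tree_iff_isParent {F : SimpleGraph V} (hF : F.IsAcyclic) {p w : V} :
    (p, w) ∈ (nfs F).tree ↔ IsParent F p w := by
  obtain ⟨k, rest, h⟩ := exists_isActive F p
  rw [h.mem_tree_iff, h.isParent_iff hF]

theorem phi_eq_self {F : SimpleGraph V} (hF : F.IsAcyclic) : Phi F = F := by
  refine le_antisymm (phi_le F) fun v w h => phi_adj.2 ?_
  rw [mem_tree_iff_isParent hF, mem_tree_iff_isParent hF]
  exact isParent_or_isParent hF h

/-- Canes are invisible to the search, and every edge outside the search forest is a cane. Hence the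
fibers of `Phi` are intervals. -/
theorem phi_eq_iff {F G : SimpleGraph V} (hF : F.IsAcyclic) :
    Phi G = F ↔ F ≤ G ∧ G ≤ F ⊔ caneGraph F := by
  constructor
  · rintro rfl
    rw [caneGraph_eq_of_stateAt_eq (stateAt_phi G)]
    exact ⟨phi_le G, le_phi_sup_caneGraph G⟩
  · rintro ⟨h1, h2⟩
    have := phi_eq_of_stateAt_eq (G := F) (G' := G)
      (stateAt_eq_of_le_of_le (by rwa [phi_eq_self hF]) (by rwa [phi_eq_self hF]))
    rw [this, phi_eq_self hF]

theorem IsActive.length_rest {F : SimpleGraph V} (hF : F.IsAcyclic) {k : ℕ} {v : V}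
    {rest : List V} (h : IsActive F k v rest) : numCanePaths F v = rest.length := by
  have ih := ((reached_stateAt F k).enterComponent.isForestState hF).stack
  rw [h] at ih
  exact ih.head

-- The canes at `v` lead to the nodes behind `v` in the pending list, and the stack invariant counts
-- these.
open Classical in
theorem card_isCane {F : SimpleGraph V} (hF : F.IsAcyclic) (v : V) :
    (Finset.univ.filter fun w => IsCane F v w).card = numCanePaths F v := by
  obtain ⟨k, rest, h⟩ := exists_isActive F v
  rw [h.length_rest hF, ← List.toFinset_card_of_nodup (List.nodup_cons.1 h.nodup).2]
  congr 1
  ext w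
  simp only [Finset.mem_filter, Finset.mem_univ, true_and, List.mem_toFinset]
  constructor
  · rintro ⟨l, r, hl, hw⟩
    obtain ⟨rfl, rfl⟩ := h.unique hl
    exact hw
  · exact fun hw => ⟨k, rest, h, hw⟩

theorem alpha_eq_sum (F : SimpleGraph V) : alpha F = ∑ v, numCanePaths F v := by
  unfold alpha
  refine Finset.sum_subset (Finset.subset_univ _) fun v _ hv => ?_
  have : v = root F v := by simpa using hv
  exact numCanePaths_of_eq_root this.symm

-- `IsCane` is asymmetric, so each cane is counted at exactly one of its ends.
open Classical in
theorem ncard_edgeSet_caneGraph {F : SimpleGraph V} (hF : F.IsAcyclic) :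
    (caneGraph F).edgeSet.ncard = alpha F := by
  rw [alpha_eq_sum]
  simp only [← card_isCane hF]
  rw [← Finset.card_sigma, ← Set.ncard_coe_finset]
  symm
  refine Set.ncard_congr (fun (x : Σ _ : V, V) _ => s(x.1, x.2)) ?_ ?_ ?_
  · rintro ⟨a, b⟩ h
    simp at h
    rw [SimpleGraph.mem_edgeSet, caneGraph_adj]
    exact Or.inl h
  · rintro ⟨a, b⟩ ⟨c, d⟩ h h' heq
    simp at h h'
    rcases Sym2.eq_iff.1 heq with ⟨h1, h2⟩ | ⟨h1, h2⟩ <;> dsimp only at h1 h2 <;> subst h1 h2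
    · rfl
    · exact absurd h' h.asymm
  · intro e
    induction e with
    | _ a b =>
      intro h
      rw [SimpleGraph.mem_edgeSet, caneGraph_adj] at h
      rcases h with h | h
      · exact ⟨⟨a, b⟩, by simpa using h, rfl⟩
      · exact ⟨⟨b, a⟩, by simpa using h, Sym2.eq_swap⟩

end Forest

/-! ### A forest is determined by its visiting order, its roots and its numbers of cane paths -/

section Uniqueness

variable {V : Type*} [Fintype V] [LinearOrder V]

theorem root_eq_self_of_entered {F : SimpleGraph V} (hF : F.IsAcyclic) {k : ℕ} {m : V}
    (hp : (stateAt F k).pending = []) (hm : m ∉ (stateAt F k).visited)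
    (he : enterComponent (stateAt F k) =
      ⟨(stateAt F k).visited ++ [m], [m], (stateAt F k).tree⟩) : root F m = m := by
  by_contra hne
  obtain ⟨p, hpm⟩ := exists_isParent (Ne.symm hne)
  have h := ((reached_stateAt F k).enterComponent.isForestState hF).parent_mem m
    (by rw [he]; simp) p hpm
  rw [he] at h
  simp only [List.mem_append, List.mem_singleton] at h
  exact hm ((isSound_stateAt F k).closed p (h.1.resolve_right h.2) (by simp [hp]) m hpm.1.symm)

theorem eq_of_append_prefix {α : Type*} {A B L : List α} {a b : α} (h1 : A ++ a :: B <+: L)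
    (h2 : A ++ [b] <+: L) : a = b := by
  have h3 : A ++ [a] <+: L := by
    exact List.IsPrefix.trans ⟨B, by simp⟩ h1
  have := List.prefix_of_prefix_length_le h3 h2 (by simp)
  simpa using this.eq_of_length (by simp)

theorem stateAt_visited_prefix_nfs (F : SimpleGraph V) {k : ℕ} (h : k ≤ Fintype.card V) :
    (stateAt F k).visited <+: (nfs F).visited :=
  (enterComponent_visited_prefix _).trans (visited_prefix_nfs F h)

/-- The nodes activated before `c` appears have no children, so each only shortens the pending list.
Then `c` is visited as the first child of some active node, and its number of cane paths equals the
length of the list left behind that node. -/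
theorem numCanePaths_next_lt {F : SimpleGraph V} (hF : F.IsAcyclic) {c : V} (hc : root F c ≠ c)
    {k : ℕ} (hk : k ≤ Fintype.card V)
    (hpre : (stateAt F k).visited ++ [c] <+: (nfs F).visited) :
    numCanePaths F c < (stateAt F k).pending.length := by
  induction hd : Fintype.card V - k generalizing k with
  | zero =>
    have : k = Fintype.card V := by omega
    subst this
    have h := hpre.length_le
    rw [show stateAt F (Fintype.card V) = nfs F from rfl] at h
    simp at h
  | succ d ih =>
    have hk' : k < Fintype.card V := by omega
    rcases hp : (stateAt F k).pending with _ | ⟨v, rest⟩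
    · have hex : ∃ w, w ∉ (stateAt F k).visited := by
        refine ⟨c, fun hcv => ?_⟩
        have := (nfs_visited_nodup F).sublist hpre.sublist
        rw [List.nodup_append] at this
        exact this.2.2 c hcv c (by simp) rfl
      obtain ⟨m, hm, he⟩ := enterComponent_pending_nil hp hex
      have h1 := visited_prefix_nfs F hk
      rw [he] at h1
      have := eq_of_append_prefix h1 hpre
      subst this
      exact absurd (root_eq_self_of_entered hF hp hm he) hc
    · have hact : IsActive F k v rest := by
        rw [IsActive, enterComponent_pending_cons hp, hp]
      have hs := hact.stateAt_succ
      rw [enterComponent_pending_cons hp] at hs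
      rcases hC : unvisitedNeighbors F (stateAt F k).visited v with _ | ⟨a, C⟩
      · have := ih (k := k + 1) (by omega) (by rw [hs]; simpa [activate, hC] using hpre) (by omega)
        rw [hs] at this
        simp [activate, hC] at this
        simp
        omega
      · have h1 := stateAt_visited_prefix_nfs F (k := k + 1) (by omega)
        rw [hs] at h1
        simp only [activate, hC] at h1
        have := eq_of_append_prefix h1 hpre
        subst this
        have hst := ((reached_stateAt F (k + 1)).isForestState hF).stack
        rw [hs] at hst
        have := hst.of_push (i := 0) (c := a) (by rw [hC]; simp)
        simp
        omega

/-- If `F'` had a further child `c`, the stack of `F'` would give `c` exactly as many cane paths as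
there are nodes pending in `F` after the common children have been pushed. In `F` the same `c` is
visited next, and `numCanePaths_next_lt` gives it fewer. -/
theorem children_eq_of_prefix {F F' : SimpleGraph V} (hF : F.IsAcyclic) (hF' : F'.IsAcyclic)
    (hL : (nfs F).visited = (nfs F').visited)
    (hj : ∀ v, numCanePaths F v = numCanePaths F' v)
    (hr : ∀ v, root F v = v ↔ root F' v = v) {k : ℕ} {v : V} {rest : List V}
    (hact : IsActive F k v rest) (hact' : IsActive F' k v rest)
    (hvis : visitedAt F k = visitedAt F' k)
    (hpre : unvisitedNeighbors F (visitedAt F k) v <+: unvisitedNeighbors F' (visitedAt F' k) v) :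
    unvisitedNeighbors F (visitedAt F k) v = unvisitedNeighbors F' (visitedAt F' k) v := by
  obtain ⟨D, hD⟩ := hpre
  rcases D with _ | ⟨c, D⟩
  · simpa using hD
  exfalso
  have hk := lt_card_of_active hact
  have hcC : c ∈ unvisitedNeighbors F' (visitedAt F' k) v := by rw [← hD]; simp
  have hc' := ((hact'.isParent_iff hF').2 (mem_unvisitedNeighbors.1 hcC)).ne_root
  have hc : root F c ≠ c := fun h => hc' ((hr c).1 h).symm
  have hs := hact.stateAt_succ
  have hs' := hact'.stateAt_succ
  have h1 : (stateAt F (k + 1)).visited ++ [c] <+: (nfs F).visited := by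
    have h2 := stateAt_visited_prefix_nfs F' (k := k + 1) (by omega)
    rw [hL]
    refine List.IsPrefix.trans ?_ h2
    rw [hs, hs']
    change visitedAt F k ++ unvisitedNeighbors F (visitedAt F k) v ++ [c] <+:
      visitedAt F' k ++ unvisitedNeighbors F' (visitedAt F' k) v
    rw [← hD, hvis]
    exact ⟨D, by simp⟩
  have h3 := numCanePaths_next_lt hF hc (k := k + 1) (by omega) h1
  rw [hs] at h3
  have hst := ((reached_stateAt F' (k + 1)).isForestState hF').stack
  rw [hs'] at hst
  have h4 := hst.of_push (i := (unvisitedNeighbors F (visitedAt F k) v).length) (c := c)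
    (by change (unvisitedNeighbors F' (visitedAt F' k) v)[_]? = _; rw [← hD]; simp)
  change _ < ((unvisitedNeighbors F (visitedAt F k) v).reverse ++ rest).length at h3
  rw [hj] at h3
  simp at h3
  omega

/-- The two searches run in step. At each activation, both lists of new nodes continue the same
visiting order, so one is a prefix of the other, and `children_eq_of_prefix` makes them equal. -/
theorem eq_of_visited_eq {F F' : SimpleGraph V} (hF : F.IsAcyclic) (hF' : F'.IsAcyclic)
    (hL : (nfs F).visited = (nfs F').visited)
    (hj : ∀ v, numCanePaths F v = numCanePaths F' v)
    (hr : ∀ v, root F v = v ↔ root F' v = v) : F = F' := by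
  have key : ∀ k, stateAt F k = stateAt F' k := by
    intro k
    induction k with
    | zero => rfl
    | succ k ih =>
      rcases h : (enterComponent (stateAt F k)).pending with _ | ⟨v, rest⟩
      · rw [stateAt_succ, stateAt_succ, ← ih, nfsStep_eq_self h, nfsStep_eq_self h]
      · have hact : IsActive F k v rest := h
        have hact' : IsActive F' k v rest := by rw [IsActive, ← ih]; exact h
        have hvis : visitedAt F k = visitedAt F' k := by unfold visitedAt; rw [ih]
        have hk := lt_card_of_active hact
        have hC : unvisitedNeighbors F (visitedAt F k) v =
            unvisitedNeighbors F' (visitedAt F' k) v := by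
          have h1 := stateAt_visited_prefix_nfs F (k := k + 1) hk
          have h2 := stateAt_visited_prefix_nfs F' (k := k + 1) hk
          rw [hact.stateAt_succ] at h1
          rw [hact'.stateAt_succ, ← hL] at h2
          change visitedAt F k ++ unvisitedNeighbors F (visitedAt F k) v <+: _ at h1
          change visitedAt F' k ++ unvisitedNeighbors F' (visitedAt F' k) v <+: _ at h2
          rw [← hvis] at h2
          rcases List.prefix_or_prefix_of_prefix h1 h2 with h | h <;>
            rw [List.prefix_append_right_inj] at h
          · rw [hvis] at h
            exact children_eq_of_prefix hF hF' hL hj hr hact hact' hvis (by rwa [hvis])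
          · exact (children_eq_of_prefix hF' hF hL.symm (fun v => (hj v).symm)
              (fun v => (hr v).symm) hact' hact hvis.symm (by rwa [← hvis])).symm
        rw [hact.stateAt_succ, hact'.stateAt_succ, ← ih]
        unfold activate
        rw [show unvisitedNeighbors F (enterComponent (stateAt F k)).visited v =
          unvisitedNeighbors F' (enterComponent (stateAt F k)).visited v by
            change unvisitedNeighbors F (visitedAt F k) v = unvisitedNeighbors F' (visitedAt F k) v
            rw [hC, hvis]]
  rw [← phi_eq_self hF, phi_eq_of_stateAt_eq key, phi_eq_self hF']

end Uniqueness

/-! ### Positions -/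

section Position

variable {V : Type*} [Fintype V] [LinearOrder V]

theorem position_lt (F : SimpleGraph V) (v : V) : position F v < Fintype.card V := by
  rw [← nfs_visited_length F]
  exact List.idxOf_lt_length_iff.2 (mem_nfs_visited F v)

theorem getElem?_position (F : SimpleGraph V) (v : V) :
    (nfs F).visited[position F v]? = some v := by
  rw [List.getElem?_eq_getElem (by rw [nfs_visited_length]; exact position_lt F v)]
  simp [position]

theorem position_injective (F : SimpleGraph V) : Function.Injective (position F) := by
  intro u v h
  have h1 := getElem?_position F u
  rw [h, getElem?_position] at h1
  exact (Option.some.inj h1).symm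

theorem exists_position_eq (F : SimpleGraph V) {i : ℕ} (hi : i < Fintype.card V) :
    ∃ v, position F v = i := by
  rw [← nfs_visited_length F] at hi
  exact ⟨(nfs F).visited[i], (nfs_visited_nodup F).idxOf_getElem i hi⟩

theorem lt_root_of_position_lt {F : SimpleGraph V} (hF : F.IsAcyclic) {u v : V}
    (h : position F u < position F v) : v < root F u := by
  have hp := (isForestState_nfs hF).pairwise
  rw [List.pairwise_iff_getElem] at hp
  have := hp _ _ (by rw [nfs_visited_length]; exact position_lt F u)
    (by rw [nfs_visited_length]; exact position_lt F v) h
  simpa [position] using this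

theorem follows_of_position_eq {F : SimpleGraph V} (hF : F.IsAcyclic) {u v : V}
    (h : position F v = position F u + 1) : Follows F u v := by
  have hp := (isForestState_nfs hF).chain
  rw [List.isChain_iff_getElem] at hp
  have := hp (position F u) (by rw [nfs_visited_length, ← h]; exact position_lt F v)
  have h2 : (nfs F).visited[position F u + 1]? = some v := by rw [← h, getElem?_position]
  rw [List.getElem?_eq_some_iff] at h2
  obtain ⟨_, h2⟩ := h2
  rw [h2] at this
  simpa [position] using this

theorem root_antitone {F : SimpleGraph V} (hF : F.IsAcyclic) {u v : V}
    (h : position F u ≤ position F v) : root F v ≤ root F u := by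
  induction hd : position F v - position F u generalizing v with
  | zero =>
    rw [position_injective F (show position F u = position F v by omega)]
  | succ d ih =>
    obtain ⟨w, hw⟩ := exists_position_eq F (i := position F v - 1)
      (by have := position_lt F v; omega)
    have h1 := ih (v := w) (by omega) (by omega)
    rcases follows_of_position_eq hF (u := w) (v := v) (by omega) with ⟨h2, h3⟩ | ⟨-, h2, -⟩
    · rw [h2]
      exact h3.le.trans h1
    · rwa [h2]

theorem position_root_le {F : SimpleGraph V} (hF : F.IsAcyclic) (v : V) :
    position F (root F v) ≤ position F v := by
  by_contra! h
  have := lt_root_of_position_lt hF h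
  exact lt_irrefl _ this

theorem position_eq_zero_iff {n : ℕ} {F : SimpleGraph (Fin (n + 1))} (hF : F.IsAcyclic)
    {v : Fin (n + 1)} : position F v = 0 ↔ v = Fin.last n := by
  have h0 : position F (Fin.last n) = 0 := by
    by_contra hne
    obtain ⟨u, hu⟩ := exists_position_eq F (i := 0) (by simp)
    exact absurd (lt_root_of_position_lt hF (u := u) (v := Fin.last n) (by omega))
      (not_lt.2 (Fin.le_last _))
  constructor
  · intro h
    exact position_injective F (h.trans h0.symm)
  · rintro rfl
    exact h0

theorem root_last {n : ℕ} (F : SimpleGraph (Fin (n + 1))) : root F (Fin.last n) = Fin.last n :=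
  le_antisymm (Fin.le_last _) (le_root F _)

theorem eq_of_position_eq {F F' : SimpleGraph V} (hF : F.IsAcyclic) (hF' : F'.IsAcyclic)
    (hpos : position F = position F') (hj : ∀ v, numCanePaths F v = numCanePaths F' v)
    (hr : ∀ v, root F v = v ↔ root F' v = v) : F = F' := by
  refine eq_of_visited_eq hF hF' (List.ext_getElem? fun i => ?_) hj hr
  rcases lt_or_ge i (Fintype.card V) with hi | hi
  · obtain ⟨v, rfl⟩ := exists_position_eq F hi
    rw [getElem?_position, hpos, getElem?_position]
  · rw [List.getElem?_eq_none (by rwa [nfs_visited_length]),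
      List.getElem?_eq_none (by rwa [nfs_visited_length])]

end Position

/-! ### Generating functions of graphs -/

section Generating

-- A graph in the interval is `F` together with a freely chosen set of edges of `C`, so the binomial
-- theorem applies.
open scoped Classical in
theorem sum_pow_ncard_edgeSet_Icc {V : Type*} [Fintype V] {F C : SimpleGraph V}
    (h : Disjoint F C) (t : ℝ) :
    ∑ G : SimpleGraph V with F ≤ G ∧ G ≤ F ⊔ C, t ^ G.edgeSet.ncard =
      t ^ F.edgeSet.ncard * (1 + t) ^ C.edgeSet.ncard := by
  have hdisj : ∀ e, e ∈ F.edgeSet → e ∉ C.edgeSet := fun e h1 h2 =>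
    Set.disjoint_left.1 (SimpleGraph.disjoint_edgeSet.2 h) h1 h2
  have hC : C.edgeSet.ncard = C.edgeFinset.card := by
    rw [← Set.ncard_coe_finset, SimpleGraph.coe_edgeFinset]
  have hpow : (1 + t) ^ C.edgeSet.ncard = ∑ S ∈ C.edgeFinset.powerset, t ^ S.card := by
    rw [hC, add_comm, ← Finset.sum_pow_mul_eq_add_pow]
    simp
  have hedge : ∀ S ∈ C.edgeFinset.powerset,
      (F ⊔ SimpleGraph.fromEdgeSet (S : Set (Sym2 V))).edgeSet = F.edgeSet ∪ S := by
    intro S hS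
    rw [SimpleGraph.edgeSet_sup, SimpleGraph.edgeSet_fromEdgeSet]
    congr 1
    ext e
    simp only [Set.mem_sdiff, and_iff_left_iff_imp]
    intro he
    exact C.not_isDiag_of_mem_edgeSet (SimpleGraph.mem_edgeFinset.1 (Finset.mem_powerset.1 hS he))
  have hSC : ∀ S ∈ C.edgeFinset.powerset, ∀ e ∈ S, e ∈ C.edgeSet := fun S hS e he =>
    SimpleGraph.mem_edgeFinset.1 (Finset.mem_powerset.1 hS he)
  rw [hpow, Finset.mul_sum]
  symm
  refine Finset.sum_bij (fun S _ => F ⊔ SimpleGraph.fromEdgeSet (S : Set (Sym2 V))) ?_ ?_ ?_ ?_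
  · intro S hS
    simp only [Finset.mem_filter, Finset.mem_univ, true_and]
    refine ⟨le_sup_left, sup_le_sup_left ?_ F⟩
    rw [← SimpleGraph.edgeSet_subset_edgeSet, SimpleGraph.edgeSet_fromEdgeSet]
    exact fun e he => hSC S hS e he.1
  · intro S hS S' hS' heq
    have h1 := congrArg SimpleGraph.edgeSet heq
    rw [hedge S hS, hedge S' hS'] at h1
    ext e
    have := Set.ext_iff.1 h1 e
    simp only [Set.mem_union, Finset.mem_coe] at this
    constructor
    · intro he
      exact (this.1 (Or.inr he)).resolve_left fun h' => hdisj e h' (hSC S hS e he)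
    · intro he
      exact (this.2 (Or.inr he)).resolve_left fun h' => hdisj e h' (hSC S' hS' e he)
  · intro G hG
    simp only [Finset.mem_filter, Finset.mem_univ, true_and] at hG
    have hmem : C.edgeFinset.filter (fun e => e ∈ G.edgeSet) ∈ C.edgeFinset.powerset :=
      Finset.mem_powerset.2 (Finset.filter_subset _ _)
    refine ⟨_, hmem, ?_⟩
    rw [← SimpleGraph.edgeSet_inj, hedge _ hmem]
    ext e
    simp only [Set.mem_union, Finset.mem_coe, Finset.mem_filter, SimpleGraph.mem_edgeFinset]
    constructor
    · rintro (h1 | h1)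
      · exact SimpleGraph.edgeSet_mono hG.1 h1
      · exact h1.2
    · intro h1
      have h2 := SimpleGraph.edgeSet_mono hG.2 h1
      rw [SimpleGraph.edgeSet_sup] at h2
      exact h2.imp id fun h3 => ⟨h3, h1⟩
  · intro S hS
    rw [hedge S hS, Set.ncard_union_eq _ (Set.toFinite _) (Set.toFinite _), pow_add,
      Set.ncard_coe_finset]
    rw [Set.disjoint_left]
    exact fun e h1 h2 => hdisj e h1 (hSC S hS e h2)

open scoped Classical in
theorem sum_pow_ncard_edgeSet_phi_eq {V : Type*} [Fintype V] [LinearOrder V] {F : SimpleGraph V}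
    (hF : F.IsAcyclic) (t : ℝ) :
    ∑ G : SimpleGraph V with Phi G = F, t ^ G.edgeSet.ncard =
      t ^ F.edgeSet.ncard * (1 + t) ^ alpha F := by
  rw [← ncard_edgeSet_caneGraph hF, ← sum_pow_ncard_edgeSet_Icc]
  · refine Finset.sum_congr ?_ fun _ _ => rfl
    ext G
    simp only [Finset.mem_filter, Finset.mem_univ, true_and]
    exact phi_eq_iff hF
  · have := disjoint_phi_caneGraph F
    rwa [phi_eq_self hF] at this

open scoped Classical in
theorem sum_pow_ncard_edgeSet {V : Type*} [Fintype V] [Fintype (SimpleGraph V)] (t : ℝ) :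
    ∑ G : SimpleGraph V, t ^ G.edgeSet.ncard = (1 + t) ^ (Fintype.card V).choose 2 := by
  have h := sum_pow_ncard_edgeSet_Icc (disjoint_bot_left : Disjoint (⊥ : SimpleGraph V) ⊤) t
  have h2 : (⊤ : SimpleGraph V).edgeSet.ncard = (Fintype.card V).choose 2 := by
    rw [← SimpleGraph.card_edgeFinset_top_eq_card_choose_two, ← Set.ncard_coe_finset,
      SimpleGraph.coe_edgeFinset]
  rw [h2, SimpleGraph.edgeSet_bot, Set.ncard_empty, pow_zero, one_mul] at h
  rw [← h]
  refine Finset.sum_congr ?_ fun _ _ => rfl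
  ext G
  simp

open scoped Classical in
theorem sum_isAcyclic_sum_phi_eq {V : Type*} [Fintype V] [LinearOrder V] (t : ℝ) :
    ∑ F : {F : SimpleGraph V // F.IsAcyclic},
        ∑ G : SimpleGraph V with Phi G = F.1, t ^ G.edgeSet.ncard =
      ∑ G : SimpleGraph V, t ^ G.edgeSet.ncard := by
  rw [← Finset.sum_fiberwise_of_maps_to (s := Finset.univ) (t := Finset.univ)
    (g := fun G : SimpleGraph V =>
      (⟨Phi G, phi_isAcyclic G⟩ : {F : SimpleGraph V // F.IsAcyclic})) (by simp)]
  refine Finset.sum_congr rfl fun F _ => Finset.sum_congr ?_ fun _ _ => rfl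
  ext G
  simp [Subtype.ext_iff]

end Generating

/-! ### The order simplex -/

section OrderSimplex

open MeasureTheory

/-- The simplex `{y : 0 ≤ y₁ ≤ … ≤ yₙ ≤ t}`. -/
def orderSimplex (n : ℕ) (t : ℝ) : Set (Fin n → ℝ) :=
  {y | Monotone y ∧ ∀ i, 0 ≤ y i ∧ y i ≤ t}

theorem isClosed_orderSimplex (n : ℕ) (t : ℝ) : IsClosed (orderSimplex n t) := by
  have h1 : IsClosed {y : Fin n → ℝ | Monotone y} := isClosed_monotone
  have h2 : IsClosed {y : Fin n → ℝ | ∀ i, 0 ≤ y i ∧ y i ≤ t} := by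
    simp only [Set.ofPred_forall, Set.ofPred_and]
    exact isClosed_iInter fun i => (isClosed_le continuous_const (continuous_apply i)).inter
      (isClosed_le (continuous_apply i) continuous_const)
  exact h1.inter h2

theorem convex_orderSimplex (n : ℕ) (t : ℝ) : Convex ℝ (orderSimplex n t) := by
  rintro x ⟨hx1, hx2⟩ y ⟨hy1, hy2⟩ a b ha hb hab
  refine ⟨fun i j hij => ?_, fun i => ⟨?_, ?_⟩⟩ <;>
    simp only [Pi.add_apply, Pi.smul_apply, smul_eq_mul]
  · have := hx1 hij
    have := hy1 hij
    gcongr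
  · have := (hx2 i).1
    have := (hy2 i).1
    positivity
  · calc a * x i + b * y i ≤ a * t + b * t := by
          have := (hx2 i).2
          have := (hy2 i).2
          gcongr
      _ = t := by rw [← add_mul, hab, one_mul]

theorem snoc_mem_orderSimplex {n : ℕ} {t u : ℝ} {z : Fin n → ℝ} :
    (Fin.snoc z u : Fin (n + 1) → ℝ) ∈ orderSimplex (n + 1) t ↔
      u ∈ Set.Icc 0 t ∧ z ∈ orderSimplex n u := by
  constructor
  · rintro ⟨h1, h2⟩
    refine ⟨by simpa using h2 (Fin.last n), fun i j hij => ?_, fun i => ⟨?_, ?_⟩⟩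
    · simpa using h1 (Fin.castSucc_le_castSucc_iff.2 hij)
    · simpa using (h2 i.castSucc).1
    · simpa using h1 (Fin.le_last i.castSucc)
  · rintro ⟨⟨h0, ht⟩, h1, h2⟩
    refine ⟨fun i j => ?_, fun i => ?_⟩
    · induction i using Fin.lastCases with
      | last =>
        intro h
        obtain rfl := Fin.last_le_iff.1 h
        exact le_rfl
      | cast i =>
        induction j using Fin.lastCases with
        | last => intro _; simpa using (h2 i).2
        | cast j => intro h; simpa using h1 (Fin.castSucc_le_castSucc_iff.1 h)
    · induction i using Fin.lastCases with
      | last => simpa using ⟨h0, ht⟩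
      | cast i => simpa using ⟨(h2 i).1, (h2 i).2.trans ht⟩

/-- The slice with last, hence largest, coordinate `u` is the order simplex of bound `u` in one
dimension less; integrate `u ^ n / n !` over `[0, t]`. -/
theorem volume_orderSimplex (n : ℕ) {t : ℝ} (ht : 0 ≤ t) :
    volume (orderSimplex n t) = ENNReal.ofReal (t ^ n / n !) := by
  induction n generalizing t with
  | zero =>
    have : orderSimplex 0 t = Set.univ := by
      ext y
      simp [orderSimplex, Subsingleton.monotone]
    rw [this, volume_pi, Measure.pi_univ]
    simp
  | succ n ih =>
    have hmp := (volume_preserving_piFinSuccAbove (fun _ : Fin (n + 1) => ℝ) (Fin.last n)).symm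
    have hmeas : MeasurableSet (orderSimplex (n + 1) t) := (isClosed_orderSimplex _ _).measurableSet
    rw [← hmp.measure_preimage hmeas.nullMeasurableSet, Measure.volume_eq_prod,
      Measure.prod_apply (hmp.measurable hmeas)]
    have hslice : ∀ u : ℝ, Prod.mk u ⁻¹'
        ((MeasurableEquiv.piFinSuccAbove (fun _ => ℝ) (Fin.last n)).symm ⁻¹'
          orderSimplex (n + 1) t) = {z | u ∈ Set.Icc 0 t ∧ z ∈ orderSimplex n u} := by
      intro u
      ext z
      rw [Set.mem_ofPred_eq, ← snoc_mem_orderSimplex]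
      simp only [Set.mem_preimage]
      rw [MeasurableEquiv.piFinSuccAbove_symm_apply, Fin.insertNthEquiv_last]
      rfl
    have hfun : (fun u : ℝ => volume (Prod.mk u ⁻¹'
        ((MeasurableEquiv.piFinSuccAbove (fun _ => ℝ) (Fin.last n)).symm ⁻¹'
          orderSimplex (n + 1) t))) =
        (Set.Icc 0 t).indicator fun u => ENNReal.ofReal (u ^ n / n !) := by
      funext u
      rw [hslice]
      by_cases hu : u ∈ Set.Icc 0 t
      · rw [Set.indicator_of_mem hu, ← ih hu.1]
        simp [hu.1, hu.2]
      · rw [Set.indicator_of_notMem hu]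
        simp only [hu, false_and, Set.ofPred_false, measure_empty]
    rw [hfun, lintegral_indicator measurableSet_Icc, ← ofReal_integral_eq_lintegral_ofReal]
    · rw [integral_Icc_eq_integral_Ioc, ← intervalIntegral.integral_of_le ht,
        intervalIntegral.integral_div, integral_pow]
      congr 1
      rw [Nat.factorial_succ]
      push_cast
      field_simp
      simp
    · exact (by fun_prop : Continuous fun u : ℝ => u ^ n / (n ! : ℝ)).integrableOn_Icc
    · filter_upwards [ae_restrict_mem measurableSet_Icc] with u hu
      have := hu.1
      positivity

/-- At an interior point, any single coordinate can be moved a little both ways without violating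
the inequalities. -/
theorem strict_of_mem_interior_orderSimplex {n : ℕ} {t : ℝ} {y : Fin n → ℝ}
    (hy : y ∈ interior (orderSimplex n t)) : StrictMono y ∧ ∀ i, 0 < y i ∧ y i < t := by
  have key : ∀ i, ∃ ε > 0, y + Pi.single i ε ∈ orderSimplex n t ∧
      y + Pi.single i (-ε) ∈ orderSimplex n t := by
    intro i
    have hc : Continuous fun a : ℝ => y + Pi.single i a :=
      continuous_const.add (continuous_single (A := fun _ => ℝ) i)
    have hnhds : (fun a : ℝ => y + Pi.single i a) ⁻¹' orderSimplex n t ∈ nhds 0 := by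
      refine hc.continuousAt.preimage_mem_nhds ?_
      simpa using mem_interior_iff_mem_nhds.1 hy
    obtain ⟨ε, hε, hball⟩ := Metric.mem_nhds_iff.1 hnhds
    refine ⟨ε / 2, by positivity, hball ?_, hball ?_⟩ <;>
      rw [Metric.mem_ball, dist_zero_right, Real.norm_eq_abs]
    · rw [abs_of_pos (by positivity)]; linarith
    · rw [abs_neg, abs_of_pos (by positivity)]; linarith
  refine ⟨fun i k hik => ?_, fun i => ?_⟩
  · obtain ⟨ε, hε, h, -⟩ := key i
    have := h.1 hik.le
    simp [hik.ne'] at this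
    linarith
  · obtain ⟨ε, hε, h1, h2⟩ := key i
    have h3 := (h1.2 i).2
    have h4 := (h2.2 i).1
    simp at h3 h4
    exact ⟨by linarith, by linarith⟩

/-- The vertices of the order simplex. -/
def orderVertex (n : ℕ) (t : ℝ) (m : Fin (n + 1)) : Fin n → ℝ :=
  fun k => if (m : ℕ) ≤ k then t else 0

theorem orderVertex_mem {n : ℕ} {t : ℝ} (ht : 0 ≤ t) (m : Fin (n + 1)) :
    orderVertex n t m ∈ orderSimplex n t := by
  refine ⟨fun i k hik => ?_, fun i => ?_⟩ <;> unfold orderVertex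
  · have : (i : ℕ) ≤ k := hik
    split_ifs <;> first | omega | simp
  · split_ifs <;> simp [ht]

theorem affineIndependent_orderVertex (n : ℕ) {t : ℝ} (ht : t ≠ 0) :
    AffineIndependent ℝ (orderVertex n t) := by
  rw [affineIndependent_iff]
  intro s w hw hsum
  -- All initial sums of the weights vanish: coordinate `i` of the vanishing combination is `t`
  -- times the sum of the weights with index at most `i`, and the full sum is zero by assumption.
  have hA : ∀ i ≤ n + 1, ∑ m ∈ s.filter (fun m : Fin (n + 1) => (m : ℕ) < i), w m = 0 := by
    intro i hi
    rcases i with _ | i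
    · simp
    · rcases (show i ≤ n by omega).lt_or_eq with h | rfl
      · have := congrFun hsum ⟨i, h⟩
        simp only [Finset.sum_apply, Pi.smul_apply, orderVertex, smul_eq_mul, mul_ite, mul_zero,
          Pi.zero_apply] at this
        rw [← Finset.sum_filter, ← Finset.sum_mul] at this
        simpa [ht, Nat.lt_succ_iff] using this
      · rw [Finset.filter_true_of_mem fun m _ => m.2]
        exact hw
  intro e he
  have h1 := hA (e + 1) e.2
  have h2 := hA e e.2.le
  have : (s.filter fun m : Fin (n + 1) => (m : ℕ) < e + 1) =
      insert e (s.filter fun m : Fin (n + 1) => (m : ℕ) < e) := by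
    ext m
    simp only [Finset.mem_filter, Finset.mem_insert, Fin.ext_iff]
    constructor
    · rintro ⟨h, h'⟩
      by_cases hme : (m : ℕ) = e
      · exact Or.inl hme
      · exact Or.inr ⟨h, by omega⟩
    · rintro (h | ⟨h, h'⟩)
      · exact ⟨(Fin.ext h : m = e) ▸ he, by omega⟩
      · exact ⟨h, by omega⟩
  rw [this, Finset.sum_insert (by simp), h2, add_zero] at h1
  exact h1

/-- A point of the order simplex lies in the hull of those vertices at which it jumps. -/
theorem mem_convexHull_orderVertex {n : ℕ} {t : ℝ} (ht : 0 < t) {y : Fin n → ℝ}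
    (hy : y ∈ orderSimplex n t) :
    y ∈ convexHull ℝ (orderVertex n t ''
      {m | (Fin.cons 0 y : Fin (n + 1) → ℝ) m < (Fin.snoc y t : Fin (n + 1) → ℝ) m}) := by
  classical
  -- `d` runs through `0, y 0, …, y (n - 1), t`, so `y k` is `d (k + 1)`. Its increments divided by
  -- `t` are the barycentric coordinates of `y`.
  let d : ℕ → ℝ := fun i => if i = 0 then 0 else if h : i - 1 < n then y ⟨i - 1, h⟩ else t
  have hcons : ∀ m : Fin (n + 1), (Fin.cons 0 y : Fin (n + 1) → ℝ) m = d m := by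
    intro m
    refine Fin.cases ?_ (fun k => ?_) m
    · simp [d]
    · simp [d]
  have hsnoc : ∀ m : Fin (n + 1), (Fin.snoc y t : Fin (n + 1) → ℝ) m = d (m + 1) := by
    intro m
    refine Fin.lastCases ?_ (fun k => ?_) m
    · simp [d]
    · simp [d]
  have hmono : ∀ m : Fin (n + 1), d m ≤ d (m + 1) := by
    intro m
    rcases m with ⟨_ | i, hi⟩
    · by_cases h : 0 < n
      · simpa [d, h] using (hy.2 _).1
      · simpa [d, h] using ht.le
    · have hin : i < n := by omega
      by_cases h : i + 1 < n
      · simpa [d, h, hin] using hy.1 (by simp : (⟨i, hin⟩ : Fin n) ≤ ⟨i + 1, h⟩)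
      · simpa [d, h, hin] using (hy.2 _).2
  have htot : ∑ m : Fin (n + 1), (d (m + 1) - d m) = t := by
    rw [Fin.sum_univ_eq_sum_range (fun i => d (i + 1) - d i), Finset.sum_range_sub]
    simp [d]
  have hpart : ∀ k : Fin n, ∑ m : Fin (n + 1), (if (m : ℕ) ≤ k then d (m + 1) - d m else 0) = y k := by
    intro k
    rw [Fin.sum_univ_eq_sum_range (fun i => if i ≤ (k : ℕ) then d (i + 1) - d i else 0),
      ← Finset.sum_filter]
    have : (Finset.range (n + 1)).filter (fun i => i ≤ (k : ℕ)) = Finset.range (k + 1) := by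
      ext i
      simp only [Finset.mem_filter, Finset.mem_range]
      omega
    rw [this, Finset.sum_range_sub]
    simp [d]
  have hJ : ∀ m : Fin (n + 1), (d (m + 1) - d m) / t ≠ 0 → d m < d (m + 1) := by
    intro m hm
    refine lt_of_le_of_ne (hmono m) fun h => hm ?_
    rw [h, sub_self, zero_div]
  have hrepr : y = ∑ m ∈ Finset.univ.filter (fun m : Fin (n + 1) => d m < d (m + 1)),
      ((d (m + 1) - d m) / t) • orderVertex n t m := by
    rw [Finset.sum_filter_of_ne fun m _ hm => hJ m fun h => hm (by rw [h, zero_smul])]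
    funext k
    rw [Finset.sum_apply, ← hpart k]
    refine Finset.sum_congr rfl fun m _ => ?_
    simp only [orderVertex, Pi.smul_apply, smul_eq_mul]
    split_ifs <;> field_simp
    simp
  have hset : {m | (Fin.cons 0 y : Fin (n + 1) → ℝ) m < (Fin.snoc y t : Fin (n + 1) → ℝ) m} =
      {m : Fin (n + 1) | d m < d (m + 1)} := by
    simp only [hcons, hsnoc]
  rw [hset, hrepr]
  refine (convex_convexHull ℝ _).sum_mem ?_ ?_ ?_
  · intro m _
    have := hmono m
    exact div_nonneg (by linarith) ht.le
  · rw [Finset.sum_filter_of_ne fun m _ hm => hJ m hm, ← Finset.sum_div, htot, div_self ht.ne']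
  · intro m hm
    refine subset_convexHull ℝ _ ⟨m, ?_, rfl⟩
    simpa using hm

theorem orderSimplex_eq_convexHull (n : ℕ) {t : ℝ} (ht : 0 < t) :
    orderSimplex n t = convexHull ℝ (Set.range (orderVertex n t)) := by
  refine Set.Subset.antisymm (fun y hy => ?_) (convexHull_min ?_ (convex_orderSimplex n t))
  · exact convexHull_mono (Set.image_subset_range _ _) (mem_convexHull_orderVertex ht hy)
  · rintro _ ⟨m, rfl⟩
    exact orderVertex_mem ht.le m

/-! ### The volume of the Gayley polytope -/

/-- Dividing `x_i` by `(1 + t) ^ i` turns the inequalities into `1 ≥ z₁ ≥ … ≥ zₙ ≥ 0`; reversing the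
order of the coordinates gives the order simplex. -/
theorem gayleyPolytope_eq_image {n : ℕ} {t : ℝ} (ht : 0 ≤ t) :
    gayleyPolytope n t = Matrix.toLin'
      ((Matrix.diagonal fun k : Fin n => (1 + t) ^ ((Fin.rev k : ℕ) + 1)).submatrix
        Fin.revPerm id) '' orderSimplex n 1 := by
  have happly : ∀ (y : Fin n → ℝ) i, Matrix.toLin'
      ((Matrix.diagonal fun k : Fin n => (1 + t) ^ ((Fin.rev k : ℕ) + 1)).submatrix
        Fin.revPerm id) y i = (1 + t) ^ ((i : ℕ) + 1) * y i.rev := by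
    intro y i
    rw [Matrix.toLin'_apply, Matrix.mulVec, dotProduct]
    rw [Finset.sum_eq_single i.rev]
    · simp only [Matrix.submatrix_apply, Matrix.diagonal_apply, Fin.revPerm_apply, id, if_true,
        Fin.rev_rev]
    · intro b _ hb
      simp [hb.symm]
    · simp
  have h1 : (0 : ℝ) < 1 + t := by linarith
  ext x
  constructor
  · intro hx
    have hstep : ∀ i (hi : i + 1 < n), x ⟨i + 1, hi⟩ / (1 + t) ^ (i + 1 + 1) ≤
        x ⟨i, by omega⟩ / (1 + t) ^ (i + 1) := by
      intro i hi
      have := (hx ⟨i + 1, hi⟩).2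
      simp only [xCoord, show i < n by omega, dif_pos] at this
      rw [pow_succ _ (i + 1), ← div_div, div_le_iff₀ h1, div_mul_eq_mul_div]
      gcongr
      linarith
    have hanti : ∀ i k (hi : i < n) (hk : k < n), i ≤ k →
        x ⟨k, hk⟩ / (1 + t) ^ (k + 1) ≤ x ⟨i, hi⟩ / (1 + t) ^ (i + 1) := by
      intro i k hi hk hik
      induction k, hik using Nat.le_induction with
      | base => exact le_rfl
      | succ k _ ih => exact (hstep k hk).trans (ih (by omega))
    refine ⟨fun k => x k.rev / (1 + t) ^ ((k.rev : ℕ) + 1), ⟨fun a b hab => ?_, fun a => ⟨?_, ?_⟩⟩, ?_⟩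
    · exact hanti _ _ b.rev.2 a.rev.2 (Fin.rev_le_rev.2 hab)
    · have := (hx a.rev).1
      positivity
    · refine (hanti 0 _ (by have := a.2; omega) a.rev.2 (Nat.zero_le _)).trans ?_
      rw [div_le_one (by positivity)]
      have := (hx ⟨0, by have := a.2; omega⟩).2
      simpa [xCoord] using this
    · funext i
      rw [happly]
      simp only [Fin.rev_rev]
      field_simp
  · rintro ⟨y, ⟨hy1, hy2⟩, rfl⟩ i
    rw [happly]
    have h0 := (hy2 i.rev).1
    refine ⟨by positivity, ?_⟩
    rcases i with ⟨_ | i, hi⟩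
    · have h2 := (hy2 (Fin.rev ⟨0, hi⟩)).2
      simp only [xCoord]
      simpa using mul_le_of_le_one_right h1.le h2
    · simp only [xCoord, show i < n by omega, dif_pos]
      rw [happly, pow_succ, mul_comm _ (1 + t), mul_assoc]
      gcongr
      exact hy1 (Fin.rev_le_rev.2 (by simp))

theorem volume_gayleyPolytope (n : ℕ) {t : ℝ} (ht : 0 ≤ t) :
    (n ! : ℝ≥0∞) * volume (gayleyPolytope n t) = ENNReal.ofReal ((1 + t) ^ (n + 1).choose 2) := by
  have h1 : (0 : ℝ) < 1 + t := by linarith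
  rw [gayleyPolytope_eq_image ht, Measure.addHaar_image_linearMap, LinearMap.det_toLin',
    Matrix.det_permute, Matrix.det_diagonal, volume_orderSimplex n zero_le_one]
  have hdet : |((Equiv.Perm.sign (Fin.revPerm : Equiv.Perm (Fin n)) : ℤ) : ℝ) *
      ∏ k : Fin n, (1 + t) ^ ((k.rev : ℕ) + 1)| = (1 + t) ^ (n + 1).choose 2 := by
    have hs : |((Equiv.Perm.sign (Fin.revPerm : Equiv.Perm (Fin n)) : ℤ) : ℝ)| = 1 := by
      rcases Int.units_eq_one_or (Equiv.Perm.sign (Fin.revPerm : Equiv.Perm (Fin n))) with h | h <;>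
        simp [h]
    have hp : (0 : ℝ) ≤ ∏ k : Fin n, (1 + t) ^ ((k.rev : ℕ) + 1) :=
      Finset.prod_nonneg fun k _ => by positivity
    have hsum : ∑ k : Fin n, ((k.rev : ℕ) + 1) = (n + 1).choose 2 := by
      have h2 := Equiv.sum_comp Fin.revPerm (fun k : Fin n => (k : ℕ) + 1)
      simp only [Fin.revPerm_apply] at h2
      have h3 := Finset.sum_range_succ' (fun i => i) n
      rw [h2, Fin.sum_univ_eq_sum_range (fun i => i + 1), Nat.choose_two_right,
        ← Finset.sum_range_id, h3, add_zero]
    rw [abs_mul, hs, one_mul, abs_of_nonneg hp, Finset.prod_pow_eq_pow_sum, hsum]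
  rw [hdet, ← ENNReal.ofReal_natCast, ← ENNReal.ofReal_mul (by positivity),
    ← ENNReal.ofReal_mul (by positivity)]
  congr 1
  field_simp
  simp

end OrderSimplex

/-! ### Parametrization of the forest simplices -/

section Parametrization

open MeasureTheory

variable {n : ℕ} {F : SimpleGraph (Fin (n + 1))}

theorem position_castSucc_ne_zero (hF : F.IsAcyclic) (k : Fin n) : position F k.castSucc ≠ 0 := by
  rw [Ne, position_eq_zero_iff hF]
  exact (Fin.castSucc_lt_last k).ne

/-- The bijection from the positions `1, …, n` to the nodes different from the largest one. -/
def nodeEquiv (hF : F.IsAcyclic) : Fin n ≃ Fin n :=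
  (Equiv.ofBijective
    (fun k : Fin n => (⟨position F k.castSucc - 1, by
      have := position_lt F k.castSucc
      have := position_castSucc_ne_zero hF k
      simp only [Fintype.card_fin] at *
      omega⟩ : Fin n))
    (Finite.injective_iff_bijective.1 (by
      intro a b h
      have h1 := position_castSucc_ne_zero hF a
      have h2 := position_castSucc_ne_zero hF b
      have h3 : position F a.castSucc = position F b.castSucc := by
        have := congrArg Fin.val h
        simp only at this
        omega
      exact Fin.castSucc_injective n (position_injective F h3)))).symm

theorem position_nodeEquiv (hF : F.IsAcyclic) (i : Fin n) :
    position F (nodeEquiv hF i).castSucc = i + 1 := by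
  have h := congrArg Fin.val ((nodeEquiv hF).symm_apply_apply i)
  have h1 := position_castSucc_ne_zero hF (nodeEquiv hF i)
  change position F (nodeEquiv hF i).castSucc - 1 = i at h
  omega

/-- The factor with which the coordinate of the node `k` enters the coordinate at its position. -/
def nodeScale (F : SimpleGraph (Fin (n + 1))) (t : ℝ) (k : Fin (n + 1)) : ℝ :=
  if k = root F k then 1 / t else (1 + t) ^ numCanePaths F k

/-- The value at the position of the node `k` of the point whose node coordinates are `y`. -/
def nodeValue (F : SimpleGraph (Fin (n + 1))) (t : ℝ) (y : Fin (n + 1) → ℝ) (k : Fin (n + 1)) : ℝ :=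
  -- The coordinate of a root is `t` times the value at its position, hence the division by `t`.
  nodeScale F t k * (y k + if k = root F k then 0 else y (root F k) / t)

/-- The point of `ℝⁿ` whose node coordinates are those of `y`, followed by `t`. -/
def pointOf (hF : F.IsAcyclic) (t : ℝ) (y : Fin n → ℝ) : Fin n → ℝ :=
  fun i => nodeValue F t (Fin.snoc y t) (nodeEquiv hF i).castSucc

/-- The node coordinates of a point, except for the last one. -/
def nodeCoords (F : SimpleGraph (Fin (n + 1))) (t : ℝ) (x : Fin n → ℝ) : Fin n → ℝ :=
  fun k => coord F t x k.castSucc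

theorem xCoord_succ {x : Fin n → ℝ} (i : Fin n) : xCoord x (i + 1) = x i := by
  simp [xCoord]

theorem xCoord_position_castSucc (hF : F.IsAcyclic) (x : Fin n → ℝ) (k : Fin n) :
    xCoord x (position F k.castSucc) = x ((nodeEquiv hF).symm k) := by
  rw [← xCoord_succ (x := x) ((nodeEquiv hF).symm k), ← position_nodeEquiv hF,
    Equiv.apply_symm_apply]

theorem xCoord_position_last (hF : F.IsAcyclic) (x : Fin n → ℝ) :
    xCoord x (position F (Fin.last n)) = 1 := by
  rw [(position_eq_zero_iff hF).2 rfl]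
  rfl

theorem coord_last (hF : F.IsAcyclic) (t : ℝ) (x : Fin n → ℝ) : coord F t x (Fin.last n) = t := by
  unfold coord
  rw [if_pos (root_last F).symm, xCoord_position_last hF, mul_one]

theorem snoc_nodeCoords (hF : F.IsAcyclic) (t : ℝ) (x : Fin n → ℝ) :
    (Fin.snoc (nodeCoords F t x) t : Fin (n + 1) → ℝ) = coord F t x := by
  funext k
  refine Fin.lastCases ?_ (fun k => ?_) k
  · rw [coord_last hF, Fin.snoc_last]
  · rw [Fin.snoc_castSucc]
    rfl

theorem xCoord_pointOf (hF : F.IsAcyclic) {t : ℝ} (ht : t ≠ 0) (y : Fin n → ℝ)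
    (k : Fin (n + 1)) :
    xCoord (pointOf hF t y) (position F k) = nodeValue F t (Fin.snoc y t) k := by
  refine Fin.lastCases ?_ (fun k => ?_) k
  · rw [xCoord_position_last hF]
    simp [nodeValue, nodeScale, root_last, ht]
  · rw [xCoord_position_castSucc hF]
    unfold pointOf
    rw [Equiv.apply_symm_apply]

theorem coord_pointOf (hF : F.IsAcyclic) {t : ℝ} (ht : 0 < t) (y : Fin n → ℝ) :
    coord F t (pointOf hF t y) = (Fin.snoc y t : Fin (n + 1) → ℝ) := by
  funext k
  have h1 : (0 : ℝ) < 1 + t := by linarith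
  unfold coord
  rw [xCoord_pointOf hF ht.ne', xCoord_pointOf hF ht.ne']
  unfold nodeValue nodeScale
  simp only [root_root, if_true, add_zero]
  split_ifs with h
  · field_simp
    rw [add_zero]
  · field_simp
    ring

theorem nodeCoords_pointOf (hF : F.IsAcyclic) {t : ℝ} (ht : 0 < t) (y : Fin n → ℝ) :
    nodeCoords F t (pointOf hF t y) = y := by
  funext k
  unfold nodeCoords
  rw [coord_pointOf hF ht, Fin.snoc_castSucc]

theorem nodeValue_coord {t : ℝ} (ht : 0 < t) (x : Fin n → ℝ) (k : Fin (n + 1)) :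
    nodeValue F t (coord F t x) k = xCoord x (position F k) := by
  have h1 : (0 : ℝ) < 1 + t := by linarith
  unfold nodeValue nodeScale coord
  simp only [root_root, if_true]
  split_ifs with h
  · field_simp
    ring
  · field_simp
    ring

theorem pointOf_nodeCoords (hF : F.IsAcyclic) {t : ℝ} (ht : 0 < t) (x : Fin n → ℝ) :
    pointOf hF t (nodeCoords F t x) = x := by
  funext i
  unfold pointOf
  rw [snoc_nodeCoords hF, nodeValue_coord ht, position_nodeEquiv, xCoord_succ]

theorem monotone_snoc_iff {t : ℝ} (ht : 0 ≤ t) {y : Fin n → ℝ} :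
    y ∈ orderSimplex n t ↔ 0 ≤ (Fin.snoc y t : Fin (n + 1) → ℝ) 0 ∧
      Monotone (Fin.snoc y t : Fin (n + 1) → ℝ) := by
  have h : y ∈ orderSimplex n t ↔ (Fin.snoc y t : Fin (n + 1) → ℝ) ∈ orderSimplex (n + 1) t := by
    rw [snoc_mem_orderSimplex]
    simp [ht]
  rw [h]
  constructor
  · rintro ⟨h1, h2⟩
    exact ⟨(h2 0).1, h1⟩
  · rintro ⟨h1, h2⟩
    refine ⟨h2, fun i => ⟨h1.trans (h2 (Fin.zero_le i)), ?_⟩⟩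
    simpa using h2 (Fin.le_last i)

theorem mem_forestSimplex_iff (hF : F.IsAcyclic) {t : ℝ} (ht : 0 ≤ t) {x : Fin n → ℝ} :
    x ∈ forestSimplex F t ↔ nodeCoords F t x ∈ orderSimplex n t := by
  rw [monotone_snoc_iff ht, snoc_nodeCoords hF]
  unfold forestSimplex
  simp [coord_last hF]

theorem pointOf_mem_iff (hF : F.IsAcyclic) {t : ℝ} (ht : 0 < t) {y : Fin n → ℝ} :
    pointOf hF t y ∈ forestSimplex F t ↔ y ∈ orderSimplex n t := by
  rw [mem_forestSimplex_iff hF ht.le, nodeCoords_pointOf hF ht]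

theorem forestSimplex_eq_image (hF : F.IsAcyclic) {t : ℝ} (ht : 0 < t) :
    forestSimplex F t = pointOf hF t '' orderSimplex n t := by
  ext x
  constructor
  · intro hx
    exact ⟨_, (mem_forestSimplex_iff hF ht.le).1 hx, pointOf_nodeCoords hF ht x⟩
  · rintro ⟨y, hy, rfl⟩
    exact (pointOf_mem_iff hF ht).2 hy

/-- The matrix of the linear part of `pointOf`, with rows indexed by nodes. -/
def pointMatrix (F : SimpleGraph (Fin (n + 1))) (t : ℝ) : Matrix (Fin n) (Fin n) ℝ :=
  Matrix.of fun k l => nodeScale F t k.castSucc * ((if k = l then 1 else 0) +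
    if k.castSucc ≠ root F k.castSucc ∧ l.castSucc = root F k.castSucc then 1 / t else 0)

theorem sum_castSucc_eq (y : Fin n → ℝ) (r : Fin (n + 1)) :
    ∑ l : Fin n, (if l.castSucc = r then y l else 0) = (Fin.snoc y 0 : Fin (n + 1) → ℝ) r := by
  refine Fin.lastCases ?_ (fun r => ?_) r
  · simp [(Fin.castSucc_lt_last _).ne]
  · simp

/-- Padding with `0` instead of `t` drops the contribution of the largest node, which is the
constant part of `pointOf`. -/
theorem pointMatrix_mulVec (F : SimpleGraph (Fin (n + 1))) (t : ℝ) (y : Fin n → ℝ) (k : Fin n) :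
    (pointMatrix F t).mulVec y k = nodeValue F t (Fin.snoc y 0) k.castSucc := by
  unfold nodeValue
  rw [Fin.snoc_castSucc, Matrix.mulVec, dotProduct]
  simp only [pointMatrix, Matrix.of_apply, mul_assoc, add_mul, ← Finset.mul_sum,
    Finset.sum_add_distrib]
  congr 2
  · simp
  · split_ifs with h
    · simp [← h]
    · rw [← sum_castSucc_eq, Finset.sum_div]
      refine Finset.sum_congr rfl fun l _ => ?_
      by_cases hl : l.castSucc = root F k.castSucc
      · simp only [hl, h, ne_eq, not_false_eq_true, and_self, if_true]
        ring
      · simp [hl]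

/-- `pointOf` as an affine map. -/
def pointMap (hF : F.IsAcyclic) (t : ℝ) : (Fin n → ℝ) →ᵃ[ℝ] (Fin n → ℝ) :=
  (Matrix.toLin' ((pointMatrix F t).submatrix (nodeEquiv hF) id)).toAffineMap +
    AffineMap.const ℝ _ (pointOf hF t 0)

theorem pointMap_apply (hF : F.IsAcyclic) (t : ℝ) (y : Fin n → ℝ) :
    pointMap hF t y = pointOf hF t y := by
  funext i
  have h : Matrix.toLin' ((pointMatrix F t).submatrix (nodeEquiv hF) id) y i =
      (pointMatrix F t).mulVec y (nodeEquiv hF i) := rfl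
  have hs : ∀ k, (Fin.snoc y t : Fin (n + 1) → ℝ) k =
      (Fin.snoc y 0 : Fin (n + 1) → ℝ) k + (Fin.snoc (0 : Fin n → ℝ) t : Fin (n + 1) → ℝ) k := by
    intro k
    refine Fin.lastCases ?_ (fun k => ?_) k <;> simp
  simp only [pointMap, AffineMap.coe_add, LinearMap.coe_toAffineMap, AffineMap.coe_const,
    Pi.add_apply, Function.const_apply]
  rw [h, pointMatrix_mulVec]
  unfold pointOf nodeValue
  rw [hs, hs (root F _)]
  split_ifs <;> ring

theorem coe_pointMap (hF : F.IsAcyclic) (t : ℝ) : ⇑(pointMap hF t) = pointOf hF t :=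
  funext (pointMap_apply hF t)

theorem pointOf_injective (hF : F.IsAcyclic) {t : ℝ} (ht : 0 < t) :
    Function.Injective (pointOf hF t) :=
  Function.LeftInverse.injective (nodeCoords_pointOf hF ht)

theorem forestSimplex_eq_convexHull (hF : F.IsAcyclic) {t : ℝ} (ht : 0 < t) :
    forestSimplex F t = convexHull ℝ (Set.range fun m => pointOf hF t (orderVertex n t m)) := by
  rw [forestSimplex_eq_image hF ht, orderSimplex_eq_convexHull n ht, ← coe_pointMap,
    AffineMap.image_convexHull, ← Set.range_comp]
  rfl

theorem convex_forestSimplex (hF : F.IsAcyclic) {t : ℝ} (ht : 0 < t) :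
    Convex ℝ (forestSimplex F t) := by
  rw [forestSimplex_eq_convexHull hF ht]
  exact convex_convexHull ℝ _

theorem isCompact_forestSimplex (hF : F.IsAcyclic) {t : ℝ} (ht : 0 < t) :
    IsCompact (forestSimplex F t) := by
  rw [forestSimplex_eq_convexHull hF ht]
  exact Set.Finite.isCompact_convexHull (𝕜 := ℝ) (Set.finite_range _)

theorem isFullSimplex_forestSimplex (hF : F.IsAcyclic) {t : ℝ} (ht : 0 < t) :
    IsFullSimplex (forestSimplex F t) := by
  refine ⟨_, ?_, forestSimplex_eq_convexHull hF ht⟩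
  have := (affineIndependent_orderVertex n ht.ne').map' (pointMap hF t)
    (by rw [coe_pointMap]; exact pointOf_injective hF ht)
  rwa [coe_pointMap] at this

/-- Each edge joins exactly one non-root to its parent. -/
theorem ncard_edgeSet_of_isAcyclic {V : Type*} [Fintype V] [LinearOrder V] {F : SimpleGraph V}
    (hF : F.IsAcyclic) :
    F.edgeSet.ncard = (Finset.univ.filter fun v => v ≠ root F v).card := by
  rw [← Set.ncard_coe_finset]
  symm
  choose! p hp using fun (v : V) (hv : v ≠ root F v) => exists_isParent hv
  refine Set.ncard_congr (fun v _ => s(v, p v)) ?_ ?_ ?_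
  · intro v hv
    exact (hp v (by simpa using hv)).1
  · intro v w hv hw h
    have h1 := hp v (by simpa using hv)
    have h2 := hp w (by simpa using hw)
    rcases Sym2.eq_iff.1 h with ⟨h, -⟩ | ⟨h3, h4⟩
    · exact h
    · have e1 := h1.2
      have e2 := h2.2
      have e3 := h1.root_eq
      rw [h4] at e1 e3
      rw [← h3, ← e3] at e2
      omega
  · intro e
    induction e with
    | _ a b =>
      intro h
      rcases isParent_or_isParent hF (show F.Adj a b from h) with h | h
      · exact ⟨b, by simpa using h.ne_root, by rw [(hp b h.ne_root).unique hF h, Sym2.eq_swap]⟩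
      · exact ⟨a, by simpa using h.ne_root, by rw [(hp a h.ne_root).unique hF h]⟩

/-- Off the diagonal, a row has an entry only in the column of the root, whose label is larger; so
the determinant is the product of the node scales up to sign. Distributing `t ^ n` over the nodes
cancels the scale `1 / t` of each root and leaves one factor `t` per non-root, that is, per edge. -/
theorem abs_det_pointMatrix (hF : F.IsAcyclic) {t : ℝ} (ht : 0 < t) :
    |((pointMatrix F t).submatrix (nodeEquiv hF) id).det| * t ^ n =
      t ^ F.edgeSet.ncard * (1 + t) ^ alpha F := by
  have h1 : (0 : ℝ) < 1 + t := by linarith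
  have hpos : ∀ k, 0 < nodeScale F t k := by
    intro k
    unfold nodeScale
    split_ifs <;> positivity
  have htri : (pointMatrix F t).BlockTriangular id := by
    intro k l hlk
    have hlk : l < k := hlk
    have h2 : ¬ (k.castSucc ≠ root F k.castSucc ∧ l.castSucc = root F k.castSucc) := by
      rintro ⟨-, h⟩
      have := le_root F k.castSucc
      rw [← h, Fin.castSucc_le_castSucc_iff] at this
      exact absurd this (not_le.2 hlk)
    simp only [pointMatrix, Matrix.of_apply, if_neg hlk.ne', if_neg h2]
    simp
  have hdet : (pointMatrix F t).det = ∏ k : Fin n, nodeScale F t k.castSucc := by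
    rw [Matrix.det_of_isUpperTriangular htri]
    refine Finset.prod_congr rfl fun k _ => ?_
    have h2 : ¬ (k.castSucc ≠ root F k.castSucc ∧ k.castSucc = root F k.castSucc) := fun h =>
      h.1 h.2
    simp only [pointMatrix, Matrix.of_apply, if_neg h2]
    simp
  have hs : |((Equiv.Perm.sign (nodeEquiv hF) : ℤ) : ℝ)| = 1 := by
    rcases Int.units_eq_one_or (Equiv.Perm.sign (nodeEquiv hF)) with h | h <;> simp [h]
  rw [Matrix.det_permute, abs_mul, hs, one_mul, hdet,
    abs_of_pos (Finset.prod_pos fun k _ => hpos _)]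
  -- The largest node is a root and adds only the factor `t * (1 / t) = 1`.
  have h3 : (∏ k : Fin n, nodeScale F t k.castSucc) * t ^ n =
      ∏ k : Fin (n + 1), (t * nodeScale F t k) := by
    rw [Fin.prod_univ_castSucc]
    have : t * nodeScale F t (Fin.last n) = 1 := by
      simp [nodeScale, root_last, ht.ne']
    rw [this, mul_one, Finset.prod_mul_distrib, Finset.prod_const, Finset.card_univ,
      Fintype.card_fin, mul_comm]
  rw [h3, ncard_edgeSet_of_isAcyclic hF]
  have h4 : ∀ k, t * nodeScale F t k =
      (if k ≠ root F k then t else 1) * (1 + t) ^ numCanePaths F k := by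
    intro k
    unfold nodeScale
    by_cases h : k = root F k
    · simp [← h, numCanePaths_of_eq_root h.symm, ht.ne']
    · simp [h]
  simp only [h4]
  rw [Finset.prod_mul_distrib, Finset.prod_pow_eq_pow_sum, alpha_eq_sum, ← Finset.prod_filter,
    Finset.prod_const]

theorem volume_forestSimplex (hF : F.IsAcyclic) {t : ℝ} (ht : 0 < t) :
    (n ! : ℝ≥0∞) * volume (forestSimplex F t) =
      ENNReal.ofReal (t ^ F.edgeSet.ncard * (1 + t) ^ alpha F) := by
  have himg : forestSimplex F t = (fun x => x + pointOf hF t 0) ''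
      (Matrix.toLin' ((pointMatrix F t).submatrix (nodeEquiv hF) id) '' orderSimplex n t) := by
    rw [forestSimplex_eq_image hF ht, Set.image_image]
    exact Set.image_congr fun y _ => (pointMap_apply hF t y).symm
  rw [himg, Set.image_add_right, measure_preimage_add_right, Measure.addHaar_image_linearMap,
    LinearMap.det_toLin', volume_orderSimplex n ht.le, ← abs_det_pointMatrix hF ht,
    ← ENNReal.ofReal_natCast, ← ENNReal.ofReal_mul (by positivity),
    ← ENNReal.ofReal_mul (by positivity)]
  congr 1
  field_simp

end Parametrization

/-! ### Coordinates of points in forest simplices -/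

section Coordinates

variable {n : ℕ} {F F' : SimpleGraph (Fin (n + 1))} {t : ℝ} {x : Fin n → ℝ}

theorem coord_nonneg (hx : x ∈ forestSimplex F t) (k : Fin (n + 1)) : 0 ≤ coord F t x k :=
  hx.1.trans (hx.2.1 (Fin.zero_le k))

theorem coord_root (F : SimpleGraph (Fin (n + 1))) (t : ℝ) (x : Fin n → ℝ) (k : Fin (n + 1)) :
    coord F t x (root F k) = t * xCoord x (position F (root F k)) := by
  unfold coord
  rw [if_pos (root_root F k).symm]

theorem xCoord_of_ne_root (ht : 0 < t) {k : Fin (n + 1)} (hk : k ≠ root F k) :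
    xCoord x (position F k) = (1 + t) ^ numCanePaths F k *
      (coord F t x k + xCoord x (position F (root F k))) := by
  have h1 : (0 : ℝ) < 1 + t := by linarith
  unfold coord
  rw [if_neg hk]
  field_simp
  ring

theorem xCoord_root_nonneg (ht : 0 < t) (hx : x ∈ forestSimplex F t) (k : Fin (n + 1)) :
    0 ≤ xCoord x (position F (root F k)) := by
  have := coord_nonneg hx (root F k)
  rw [coord_root] at this
  exact nonneg_of_mul_nonneg_right this ht

theorem coord_le_root (hx : x ∈ forestSimplex F t) (k : Fin (n + 1)) :
    coord F t x k ≤ t * xCoord x (position F (root F k)) := by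
  rw [← coord_root]
  exact hx.2.1 (le_root F k)

/-- The coordinate of a non-root lies between `0` and the coordinate `t x_l` of its root. So `x_i`
lies between `(1 + t) ^ j x_l` and `(1 + t) ^ (j + 1) x_l`; the upper half is `xCoord_le_pow_mul`.
-/
theorem pow_mul_xCoord_root_le (ht : 0 < t) (hx : x ∈ forestSimplex F t) (k : Fin (n + 1)) :
    (1 + t) ^ numCanePaths F k * xCoord x (position F (root F k)) ≤ xCoord x (position F k) := by
  by_cases hk : k = root F k
  · rw [← hk, numCanePaths_of_eq_root hk.symm]
    simp
  · rw [xCoord_of_ne_root ht hk]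
    have := coord_nonneg hx k
    gcongr
    linarith

theorem xCoord_root_le (ht : 0 < t) (hx : x ∈ forestSimplex F t) (k : Fin (n + 1)) :
    xCoord x (position F (root F k)) ≤ xCoord x (position F k) := by
  refine le_trans ?_ (pow_mul_xCoord_root_le ht hx k)
  exact le_mul_of_one_le_left (xCoord_root_nonneg ht hx k) (one_le_pow₀ (by linarith))

theorem xCoord_le_pow_mul (ht : 0 < t) (hx : x ∈ forestSimplex F t) (k : Fin (n + 1)) :
    xCoord x (position F k) ≤
      (1 + t) ^ (numCanePaths F k + 1) * xCoord x (position F (root F k)) := by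
  have h0 := xCoord_root_nonneg ht hx k
  by_cases hk : k = root F k
  · rw [← hk] at h0 ⊢
    exact le_mul_of_one_le_left h0 (one_le_pow₀ (by linarith))
  · rw [xCoord_of_ne_root ht hk, pow_succ, mul_assoc]
    have := coord_le_root hx k
    gcongr
    linarith

theorem xCoord_root_le_of_root_le (ht : 0 < t) (hx : x ∈ forestSimplex F t) {u v : Fin (n + 1)}
    (h : root F v ≤ root F u) :
    xCoord x (position F (root F v)) ≤ xCoord x (position F (root F u)) := by
  have := hx.2.1 h
  rw [coord_root, coord_root] at this
  exact le_of_mul_le_mul_left this ht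

/-- Compare consecutive positions by the cases of `Follows`. The value at a new root is at most that
at the previous root. Within a component, if the number of cane paths does not grow, the bounds by
powers of `1 + t` suffice; if it grows by one, the label and thus the node coordinate decreases, and
the extra factor is exactly `1 + t`. -/
theorem forestSimplex_subset (hF : F.IsAcyclic) (ht : 0 < t) :
    forestSimplex F t ⊆ gayleyPolytope n t := by
  intro x hx i
  have h1 : (0 : ℝ) < 1 + t := by linarith
  set v := (nodeEquiv hF i).castSucc with hv
  have hvpos : position F v = i + 1 := position_nodeEquiv hF i
  obtain ⟨u, hu⟩ := exists_position_eq F (i := i) (by have := i.2; simp)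
  have hxv : x i = xCoord x (position F v) := by rw [hvpos, xCoord_succ]
  rw [hxv, ← hu]
  refine ⟨(xCoord_root_nonneg ht hx v).trans (xCoord_root_le ht hx v), ?_⟩
  have hru := xCoord_root_nonneg ht hx u
  rcases follows_of_position_eq hF (u := u) (v := v) (by omega) with ⟨h2, h3⟩ | ⟨h2, h3, h4 | ⟨h4, h5, h6⟩⟩
  · have h4 := xCoord_root_le_of_root_le ht hx (u := u) (v := v) (by rw [h2]; exact h3.le)
    rw [h2] at h4
    have h5 := xCoord_root_le ht hx u
    nlinarith
  · calc xCoord x (position F v) ≤ (1 + t) ^ (numCanePaths F v + 1) *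
          xCoord x (position F (root F u)) := by
          rw [← h3]
          exact xCoord_le_pow_mul ht hx v
      _ ≤ (1 + t) ^ (numCanePaths F u + 1) * xCoord x (position F (root F u)) := by
          gcongr
          linarith
      _ = (1 + t) * ((1 + t) ^ numCanePaths F u * xCoord x (position F (root F u))) := by ring
      _ ≤ (1 + t) * xCoord x (position F u) := by
          gcongr
          exact pow_mul_xCoord_root_le ht hx u
  · rw [xCoord_of_ne_root ht (Ne.symm h2), xCoord_of_ne_root ht (Ne.symm h6), h3, h4, pow_succ]
    have := hx.2.1 h5.le
    calc (1 + t) ^ numCanePaths F u * (1 + t) *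
          (coord F t x v + xCoord x (position F (root F u)))
        ≤ (1 + t) ^ numCanePaths F u * (1 + t) *
          (coord F t x u + xCoord x (position F (root F u))) := by gcongr
      _ = _ := by ring

/-- In a forest simplex, the coordinate at the root of a node is the least of the coordinates at
the positions up to that of the node. -/
theorem isLeast_xCoord_root (hF : F.IsAcyclic) (ht : 0 < t) (hx : x ∈ forestSimplex F t)
    (v : Fin (n + 1)) :
    IsLeast (xCoord x '' {i | i ≤ position F v}) (xCoord x (position F (root F v))) := by
  refine ⟨⟨_, position_root_le hF v, rfl⟩, ?_⟩
  rintro _ ⟨i, hi, rfl⟩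
  have hi : i ≤ position F v := hi
  obtain ⟨u, rfl⟩ := exists_position_eq F (i := i) (hi.trans_lt (position_lt F v))
  exact (xCoord_root_le_of_root_le ht hx (root_antitone hF hi)).trans (xCoord_root_le ht hx u)

/-- The least value up to a position depends on `x` and the position, not on the forest. -/
theorem xCoord_root_eq (hF : F.IsAcyclic) (hF' : F'.IsAcyclic) (ht : 0 < t)
    (hx : x ∈ forestSimplex F t) (hx' : x ∈ forestSimplex F' t) {u u' : Fin (n + 1)}
    (h : position F u = position F' u') :
    xCoord x (position F (root F u)) = xCoord x (position F' (root F' u')) := by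
  have h1 := isLeast_xCoord_root hF ht hx u
  rw [h] at h1
  exact h1.unique (isLeast_xCoord_root hF' ht hx' u')

/-! ### Interiors of the forest simplices -/

theorem continuous_pointOf (hF : F.IsAcyclic) (t : ℝ) : Continuous (pointOf hF t) := by
  rw [← coe_pointMap]
  exact (pointMap hF t).continuous_of_finiteDimensional

theorem strictMono_coord_of_mem_interior (hF : F.IsAcyclic) (ht : 0 < t)
    (hx : x ∈ interior (forestSimplex F t)) :
    StrictMono (coord F t x) ∧ ∀ k, 0 < coord F t x k := by
  have hpre : pointOf hF t ⁻¹' forestSimplex F t = orderSimplex n t := by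
    ext y
    exact pointOf_mem_iff hF ht
  have hy : nodeCoords F t x ∈ interior (orderSimplex n t) := by
    rw [← hpre]
    refine preimage_interior_subset_interior_preimage (continuous_pointOf hF t) ?_
    rwa [Set.mem_preimage, pointOf_nodeCoords hF ht]
  obtain ⟨h1, h2⟩ := strict_of_mem_interior_orderSimplex hy
  rw [← snoc_nodeCoords hF]
  constructor
  · intro a b
    induction b using Fin.lastCases with
    | last =>
      induction a using Fin.lastCases with
      | last => exact fun h => absurd h (lt_irrefl _)
      | cast a => intro _; simpa using (h2 a).2
    | cast b =>
      induction a using Fin.lastCases with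
      | last => exact fun h => absurd h (not_lt.2 (Fin.le_last _))
      | cast a => intro h; simpa using h1 (Fin.castSucc_lt_castSucc_iff.1 h)
  · intro k
    induction k using Fin.lastCases with
    | last => simpa using ht
    | cast k => simpa using (h2 k).1

/-- In the interior, a position belongs to a root exactly if its value equals the least value so
far. Otherwise its value lies strictly between two successive powers of `1 + t` times that least
value, which fixes the number of cane paths and then the node coordinate. -/
theorem node_data_eq_of_mem_interior (hF : F.IsAcyclic) (hF' : F'.IsAcyclic) (ht : 0 < t)
    (hx : x ∈ interior (forestSimplex F t)) (hx' : x ∈ interior (forestSimplex F' t))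
    {u u' : Fin (n + 1)} (h : position F u = position F' u') :
    (u = root F u ↔ u' = root F' u') ∧ numCanePaths F u = numCanePaths F' u' ∧
      coord F t x u = coord F' t x u' := by
  have h1 : (1 : ℝ) < 1 + t := by linarith
  have hmu := xCoord_root_eq hF hF' ht (interior_subset hx) (interior_subset hx') h
  have hmu0 := xCoord_root_nonneg ht (interior_subset hx) u
  have key : ∀ {F : SimpleGraph (Fin (n + 1))}, F.IsAcyclic → x ∈ interior (forestSimplex F t) →
      ∀ {u}, u ≠ root F u →
        (1 + t) ^ numCanePaths F u * xCoord x (position F (root F u)) < xCoord x (position F u) ∧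
        xCoord x (position F u) <
          (1 + t) ^ (numCanePaths F u + 1) * xCoord x (position F (root F u)) ∧
        xCoord x (position F (root F u)) < xCoord x (position F u) := by
    intro F hF hx u hu
    obtain ⟨hmono, hpos⟩ := strictMono_coord_of_mem_interior hF ht hx
    have h2 := hpos u
    have h3 := hmono (lt_of_le_of_ne (le_root F u) hu)
    rw [coord_root] at h3
    have h4 := xCoord_root_nonneg ht (interior_subset hx) u
    have h5 : (1 + t) ^ numCanePaths F u * xCoord x (position F (root F u)) <
        xCoord x (position F u) := by
      rw [xCoord_of_ne_root ht hu]
      gcongr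
      linarith
    refine ⟨h5, ?_, lt_of_le_of_lt ?_ h5⟩
    · rw [xCoord_of_ne_root ht hu, pow_succ, mul_assoc]
      gcongr
      linarith
    · exact le_mul_of_one_le_left h4 (one_le_pow₀ h1.le)
  have hroot : u = root F u ↔ u' = root F' u' := by
    constructor
    · intro hu
      by_contra hu'
      have := (key hF' hx' hu').2.2
      rw [← hmu, ← hu, h] at this
      exact lt_irrefl _ this
    · intro hu'
      by_contra hu
      have := (key hF hx hu).2.2
      rw [hmu, ← hu', h] at this
      exact lt_irrefl _ this
  refine ⟨hroot, ?_⟩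
  by_cases hu : u = root F u
  · have hu' := hroot.1 hu
    refine ⟨by rw [numCanePaths_of_eq_root hu.symm, numCanePaths_of_eq_root hu'.symm], ?_⟩
    unfold coord
    rw [if_pos hu, if_pos hu', h]
  · have hu' : u' ≠ root F' u' := fun h => hu (hroot.2 h)
    have k1 := key hF hx hu
    have k2 := key hF' hx' hu'
    rw [← hmu, ← h] at k2
    have hle : ∀ {a b : ℕ} {m z : ℝ}, 0 ≤ m → (1 + t) ^ a * m < z → z < (1 + t) ^ (b + 1) * m →
        a ≤ b := by
      intro a b m z hm h2 h3
      have h4 := lt_of_mul_lt_mul_right (h2.trans h3) hm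
      exact Nat.lt_succ_iff.1 ((pow_lt_pow_iff_right₀ h1).1 h4)
    have hj : numCanePaths F u = numCanePaths F' u' :=
      le_antisymm (hle hmu0 k1.1 k2.2.1) (hle hmu0 k2.1 k1.2.1)
    refine ⟨hj, ?_⟩
    unfold coord
    rw [if_neg hu, if_neg hu', h, hj, hmu]

/-- Position by position the node coordinates agree, so the two coordinate functions on labels have
the same range. Being strictly increasing, they coincide, which matches labels with positions. -/
theorem eq_of_mem_interior (hF : F.IsAcyclic) (hF' : F'.IsAcyclic) (ht : 0 < t)
    (hx : x ∈ interior (forestSimplex F t)) (hx' : x ∈ interior (forestSimplex F' t)) :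
    F = F' := by
  have hm := (strictMono_coord_of_mem_interior hF ht hx).1
  have hm' := (strictMono_coord_of_mem_interior hF' ht hx').1
  have hc : coord F t x = coord F' t x := by
    refine (hm.range_inj hm').1 (Set.Subset.antisymm ?_ ?_)
    · rintro _ ⟨u, rfl⟩
      obtain ⟨u', hu'⟩ := exists_position_eq F' (position_lt F u)
      exact ⟨u', (node_data_eq_of_mem_interior hF hF' ht hx hx' hu'.symm).2.2.symm⟩
    · rintro _ ⟨u', rfl⟩
      obtain ⟨u, hu⟩ := exists_position_eq F (position_lt F' u')
      exact ⟨u, (node_data_eq_of_mem_interior hF hF' ht hx hx' hu).2.2⟩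
  have hpos : position F = position F' := by
    funext u
    obtain ⟨u', hu'⟩ := exists_position_eq F' (position_lt F u)
    have := (node_data_eq_of_mem_interior hF hF' ht hx hx' hu'.symm).2.2
    rw [hc] at this
    rw [← hu', hm'.injective this]
  refine eq_of_position_eq hF hF' hpos (fun v => ?_) fun v => ?_
  · exact (node_data_eq_of_mem_interior hF hF' ht hx hx' (congrFun hpos v)).2.1
  · rw [eq_comm, (node_data_eq_of_mem_interior hF hF' ht hx hx' (congrFun hpos v)).1, eq_comm]

/-! ### Carriers -/

/-- `IsCarrierValue t μ z s w`: `w` is `0` or the power `(1 + t) ^ k` that is determined by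
`(s + μ) (1 + t) ^ (k - 1) < z ≤ (s + μ) (1 + t) ^ k`, depending on whether `t μ ≤ s`. -/
def IsCarrierValue (t μ z s w : ℝ) : Prop :=
  (t * μ ≤ s ∧ w = 0) ∨ (s < t * μ ∧ ∃ k : ℕ, w = (1 + t) ^ k ∧ z ≤ (s + μ) * (1 + t) ^ k ∧
    (k = 0 ∨ (s + μ) * (1 + t) ^ k < (1 + t) * z))

theorem IsCarrierValue.unique {μ z s w w' : ℝ} (ht : 0 < t) (hμ : 0 ≤ μ) (hs : 0 ≤ s)
    (h : IsCarrierValue t μ z s w) (h' : IsCarrierValue t μ z s w') : w = w' := by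
  rcases h with ⟨h1, h2⟩ | ⟨h1, k, rfl, h2, h3⟩ <;>
    rcases h' with ⟨h1', h2'⟩ | ⟨h1', k', rfl, h2', h3'⟩
  · rw [h2, h2']
  · linarith
  · linarith
  · have key : ∀ {a b : ℕ}, z ≤ (s + μ) * (1 + t) ^ a →
        (b = 0 ∨ (s + μ) * (1 + t) ^ b < (1 + t) * z) → b ≤ a := by
      intro a b ha hb
      by_contra! hab
      rcases hb with hb | hb
      · omega
      · have h4 : (s + μ) * (1 + t) ^ (a + 1) ≤ (s + μ) * (1 + t) ^ b := by
          gcongr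
          · linarith
          · exact hab
        have h5 : (1 + t) * z ≤ (1 + t) * ((s + μ) * (1 + t) ^ a) := by gcongr
        rw [pow_succ] at h4
        linarith
    rw [le_antisymm (key h2' h3) (key h2 h3')]

/-- The node coordinates of the vertex of the simplex of `F` that switches on the nodes whose
coordinate exceeds `s`. -/
def threshold (F : SimpleGraph (Fin (n + 1))) (t : ℝ) (x : Fin n → ℝ) (s : ℝ) : Fin n → ℝ :=
  fun k => if s < coord F t x k.castSucc then t else 0

theorem snoc_threshold (hF : F.IsAcyclic) {s : ℝ} (hs : s < t) :
    (Fin.snoc (threshold F t x s) t : Fin (n + 1) → ℝ) =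
      fun k => if s < coord F t x k then t else 0 := by
  funext k
  refine Fin.lastCases ?_ (fun k => ?_) k
  · simp [coord_last hF, hs]
  · simp [threshold]

theorem threshold_mem (ht : 0 < t) (hx : x ∈ forestSimplex F t) (s : ℝ) :
    threshold F t x s ∈ orderSimplex n t := by
  refine ⟨fun a b hab => ?_, fun a => ?_⟩ <;> unfold threshold
  · have := hx.2.1 (Fin.castSucc_le_castSucc_iff.2 hab)
    split_ifs <;> linarith
  · split_ifs <;> simp [ht.le]

/-- If the root is switched off, so is the node, having a smaller coordinate, and the value is `0`.
If the root is on, the value is `(1 + t) ^ (j + 1)` or `(1 + t) ^ j` according to whether the node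
is on. As `z = (1 + t) ^ j (c + μ)`, the condition `s < c` can be read off from `z`, `μ` and `s`. -/
theorem isCarrierValue_pointOf_threshold (hF : F.IsAcyclic) (ht : 0 < t)
    (hx : x ∈ forestSimplex F t) {s : ℝ} (hs0 : 0 ≤ s) (hs : s < t) (k : Fin (n + 1)) :
    IsCarrierValue t (xCoord x (position F (root F k))) (xCoord x (position F k)) s
      (xCoord (pointOf hF t (threshold F t x s)) (position F k)) := by
  have h1 : (0 : ℝ) < 1 + t := by linarith
  have hμ := xCoord_root_nonneg ht hx k
  have hc := coord_le_root hx k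
  have hc0 := coord_nonneg hx k
  rw [xCoord_pointOf hF ht.ne', snoc_threshold hF hs]
  unfold nodeValue nodeScale
  simp only [coord_root]
  by_cases hk : k = root F k
  · have hck : coord F t x k = t * xCoord x (position F (root F k)) := by
      rw [← coord_root, ← hk]
    simp only [if_pos hk, hck]
    split_ifs with h
    · refine Or.inr ⟨h, 0, by field_simp; simp, ?_, Or.inl rfl⟩
      rw [← hk]
      linarith
    · exact Or.inl ⟨not_lt.1 h, by simp⟩
  · simp only [if_neg hk]
    by_cases hr : s < t * xCoord x (position F (root F k))
    · rw [if_pos hr, div_self ht.ne']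
      refine Or.inr ⟨hr, ?_⟩
      rw [xCoord_of_ne_root ht hk]
      set μ := xCoord x (position F (root F k))
      set c := coord F t x k
      set j := numCanePaths F k
      have hp : 0 < (1 + t) ^ j := by positivity
      split_ifs with h
      -- The node is on; the upper bound for `z` comes from `c ≤ t μ`.
      · refine ⟨j + 1, by ring, ?_, Or.inr ?_⟩
        · rw [pow_succ, mul_comm ((1 + t) ^ j), mul_comm ((1 + t) ^ j), ← mul_assoc]
          gcongr
          nlinarith
        · rw [pow_succ]
          have : (1 + t) ^ j * (s + μ) < (1 + t) ^ j * (c + μ) := by gcongr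
          nlinarith
      -- The node is off; the lower bound comes from `s < t μ` and `0 ≤ c`.
      · refine ⟨j, by ring, ?_, Or.inr ?_⟩
        · rw [mul_comm]
          gcongr
          exact not_lt.1 h
        · have : (s + μ) * (1 + t) ^ j < ((1 + t) * (c + μ)) * (1 + t) ^ j := by
            gcongr
            nlinarith
          linarith
    · refine Or.inl ⟨not_lt.1 hr, ?_⟩
      rw [if_neg hr, if_neg (by linarith)]
      simp

/-- By `IsCarrierValue.unique`, each coordinate of the vertex is determined by `x_i`, the least
value up to position `i`, and `s`. None of these refers to the forest. -/
theorem pointOf_threshold_eq (hF : F.IsAcyclic) (hF' : F'.IsAcyclic) (ht : 0 < t)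
    (hx : x ∈ forestSimplex F t) (hx' : x ∈ forestSimplex F' t) {s : ℝ} (hs0 : 0 ≤ s)
    (hs : s < t) :
    pointOf hF t (threshold F t x s) = pointOf hF' t (threshold F' t x s) := by
  funext i
  have h1 := isCarrierValue_pointOf_threshold hF ht hx hs0 hs (nodeEquiv hF i).castSucc
  have h2 := isCarrierValue_pointOf_threshold hF' ht hx' hs0 hs (nodeEquiv hF' i).castSucc
  rw [← xCoord_root_eq hF hF' ht hx hx' 
    ((position_nodeEquiv hF i).trans (position_nodeEquiv hF' i).symm)] at h2
  rw [position_nodeEquiv, xCoord_succ] at h1 h2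
  rw [xCoord_succ] at h1 h2
  exact h1.unique ht (xCoord_root_nonneg ht hx _) hs0 h2

/-- At a jump, cutting at the lower value switches on precisely the nodes from `m` on. So the
vertices that carry `x` are among its threshold vertices. -/
theorem threshold_cons_eq (hF : F.IsAcyclic) (hx : x ∈ forestSimplex F t) {m : Fin (n + 1)}
    (hm : (Fin.cons 0 (nodeCoords F t x) : Fin (n + 1) → ℝ) m <
      (Fin.snoc (nodeCoords F t x) t : Fin (n + 1) → ℝ) m) :
    threshold F t x ((Fin.cons 0 (nodeCoords F t x) : Fin (n + 1) → ℝ) m) = orderVertex n t m := by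
  rw [snoc_nodeCoords hF] at hm
  funext k
  unfold threshold orderVertex
  by_cases hk : (m : ℕ) ≤ k
  · rw [if_pos hk, if_pos (hm.trans_le (hx.2.1 (Fin.le_def.2 hk)))]
  · rw [if_neg hk, if_neg]
    rw [not_lt]
    induction m using Fin.cases with
    | zero => simp at hk
    | succ m =>
      rw [Fin.cons_succ]
      refine hx.2.1 (Fin.castSucc_le_castSucc_iff.2 (Fin.le_def.2 ?_))
      simp at hk
      omega

/-! ### Intersections of forest simplices -/

/-- A sum of nonnegative functions attains the value `0` only where all of them vanish. So minus the
linear part of the sum exposes the common zero set, provided this is nonempty, which is all that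
exposedness demands. -/
theorem isExposed_of_affine {E ι : Type*} [NormedAddCommGroup E] [NormedSpace ℝ E]
    [FiniteDimensional ℝ E] [Fintype ι] {A : Set E} (f : ι → E →ᵃ[ℝ] ℝ)
    (hf : ∀ x ∈ A, ∀ i, 0 ≤ f i x) : IsExposed ℝ A {x ∈ A | ∀ i, f i x = 0} := by
  rintro ⟨b, hbA, hb⟩
  refine ⟨-LinearMap.toContinuousLinearMap (∑ i, (f i).linear), ?_⟩
  have hl : ∀ x y, (-LinearMap.toContinuousLinearMap (∑ i, (f i).linear)) y ≤
      (-LinearMap.toContinuousLinearMap (∑ i, (f i).linear)) x ↔ ∑ i, f i x ≤ ∑ i, f i y := by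
    intro x y
    have : ∀ z, (-LinearMap.toContinuousLinearMap (∑ i, (f i).linear)) z =
        ∑ i, f i 0 - ∑ i, f i z := by
      intro z
      have h : ∀ i, (f i).linear z = f i z - f i 0 := by
        intro i
        have := (f i).linearMap_vsub z 0
        simpa using this
      simp [h]
    rw [this, this]
    constructor <;> intro h <;> linarith
  ext x
  simp only [Set.mem_ofPred_eq, hl]
  refine and_congr_right fun hxA => ⟨fun h y hy => ?_, fun h => ?_⟩
  · rw [Finset.sum_eq_zero fun i _ => h i]
    exact Finset.sum_nonneg fun i _ => hf y hy i
  · have h1 := h b hbA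
    rw [Finset.sum_eq_zero fun i _ => hb i] at h1
    have h2 := (Finset.sum_eq_zero_iff_of_nonneg fun i _ => hf x hxA i).1
      (le_antisymm h1 (Finset.sum_nonneg fun i _ => hf x hxA i))
    exact fun i => h2 i (Finset.mem_univ i)

theorem pointMap_bijective (hF : F.IsAcyclic) (ht : 0 < t) :
    Function.Bijective (pointMap hF t) := by
  rw [coe_pointMap]
  exact ⟨pointOf_injective hF ht, fun x => ⟨_, pointOf_nodeCoords hF ht x⟩⟩

/-- The affine map that sends the point with the node coordinates `y₁, …, yₙ` to the `m`-th of the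
differences `y₁, y₂ - y₁, …, yₙ - yₙ₋₁, t - yₙ`. -/
def gapMap (hF : F.IsAcyclic) (ht : 0 < t) (m : Fin (n + 1)) : (Fin n → ℝ) →ᵃ[ℝ] ℝ :=
  ((Fin.lastCases (AffineMap.const ℝ _ t) (fun k => (LinearMap.proj k).toAffineMap) m :
      (Fin n → ℝ) →ᵃ[ℝ] ℝ) -
    (Fin.cases (AffineMap.const ℝ _ 0) (fun k => (LinearMap.proj k).toAffineMap) m :
      (Fin n → ℝ) →ᵃ[ℝ] ℝ)).comp
  (AffineEquiv.ofBijective (pointMap_bijective hF ht)).symm.toAffineMap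

theorem gapMap_apply (hF : F.IsAcyclic) (ht : 0 < t) (m : Fin (n + 1)) (x : Fin n → ℝ) :
    gapMap hF ht m x = (Fin.snoc (nodeCoords F t x) t : Fin (n + 1) → ℝ) m -
      (Fin.cons 0 (nodeCoords F t x) : Fin (n + 1) → ℝ) m := by
  have h : (AffineEquiv.ofBijective (pointMap_bijective hF ht)).symm x =
      nodeCoords F t x := by
    rw [AffineEquiv.symm_apply_eq, AffineEquiv.ofBijective_apply, pointMap_apply,
      pointOf_nodeCoords hF ht]
  unfold gapMap
  rw [AffineMap.comp_apply, AffineEquiv.coe_toAffineMap, h, AffineMap.coe_sub, Pi.sub_apply]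
  congr 1
  · refine Fin.lastCases ?_ (fun k => ?_) m <;> simp
  · refine Fin.cases ?_ (fun k => ?_) m <;> simp

theorem gapMap_nonneg (hF : F.IsAcyclic) (ht : 0 < t) (hx : x ∈ forestSimplex F t)
    (m : Fin (n + 1)) : 0 ≤ gapMap hF ht m x := by
  rw [gapMap_apply, snoc_nodeCoords hF, sub_nonneg]
  induction m using Fin.cases with
  | zero => simpa using hx.1
  | succ m =>
    rw [Fin.cons_succ]
    exact hx.2.1 Fin.castSucc_lt_succ.le

/-- `J` collects the vertices that carry some common point. By the threshold vertices these also lie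
in the other simplex, so by convexity the intersection is the face they span, cut out by the
vanishing of the gaps outside `J`. -/
theorem isExposed_inter (hF : F.IsAcyclic) (hF' : F'.IsAcyclic) (ht : 0 < t) :
    IsExposed ℝ (forestSimplex F t) (forestSimplex F t ∩ forestSimplex F' t) := by
  classical
  let J : Set (Fin (n + 1)) :=
    {m | ∃ z ∈ forestSimplex F t ∩ forestSimplex F' t, gapMap hF ht m z ≠ 0}
  have hlt : ∀ {z : Fin n → ℝ}, z ∈ forestSimplex F t → ∀ {m}, gapMap hF ht m z ≠ 0 →
      (Fin.cons 0 (nodeCoords F t z) : Fin (n + 1) → ℝ) m <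
        (Fin.snoc (nodeCoords F t z) t : Fin (n + 1) → ℝ) m := by
    intro z hz m hm
    have := lt_of_le_of_ne (gapMap_nonneg hF ht hz m) (Ne.symm hm)
    rw [gapMap_apply] at this
    linarith
  have hvertex : ∀ m ∈ J, pointOf hF t (orderVertex n t m) ∈ forestSimplex F' t := by
    rintro m ⟨z, ⟨hz, hz'⟩, hm⟩
    have h1 := hlt hz hm
    rw [← threshold_cons_eq hF hz h1, pointOf_threshold_eq hF hF' ht hz hz']
    · exact (pointOf_mem_iff hF' ht).2 (threshold_mem ht hz' _)
    · induction m using Fin.cases with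
      | zero => simp
      | succ m => rw [Fin.cons_succ]; exact coord_nonneg hz _
    · refine h1.trans_le ?_
      rw [snoc_nodeCoords hF]
      exact (hz.2.1 (Fin.le_last m)).trans_eq (coord_last hF t z)
  have heq : forestSimplex F t ∩ forestSimplex F' t =
      {x ∈ forestSimplex F t | ∀ m : {m // m ∉ J}, gapMap hF ht m.1 x = 0} := by
    ext x
    constructor
    · intro hx
      refine ⟨hx.1, fun m => ?_⟩
      by_contra hm
      exact m.2 ⟨x, hx, hm⟩
    · rintro ⟨hx, hm⟩
      refine ⟨hx, ?_⟩
      have h1 := mem_convexHull_orderVertex ht ((mem_forestSimplex_iff hF ht.le).1 hx)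
      have h2 := Set.mem_image_of_mem (pointMap hF t) h1
      rw [AffineMap.image_convexHull, pointMap_apply, pointOf_nodeCoords hF ht] at h2
      refine convexHull_min ?_ (convex_forestSimplex hF' ht) h2
      rintro _ ⟨_, ⟨m, hmx, rfl⟩, rfl⟩
      rw [pointMap_apply]
      refine hvertex m ?_
      by_contra hmJ
      have h3 := hm ⟨m, hmJ⟩
      rw [gapMap_apply] at h3
      rw [Set.mem_ofPred_eq] at hmx
      linarith
  rw [heq]
  exact isExposed_of_affine (fun m : {m // m ∉ J} => gapMap hF ht m.1)
    fun x hx m => gapMap_nonneg hF ht hx m.1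

end Coordinates

/-! ### The triangulation -/

section Triangulation

open MeasureTheory

variable {n : ℕ} {t : ℝ}

theorem convex_gayleyPolytope (ht : 0 ≤ t) : Convex ℝ (gayleyPolytope n t) := by
  rw [gayleyPolytope_eq_image ht]
  exact (convex_orderSimplex n 1).linear_image _

/-- A common point is not interior to both simplices, so it lies on one of the frontiers, and
frontiers of convex sets are null sets. -/
theorem volume_inter_forestSimplex {F F' : SimpleGraph (Fin (n + 1))} (hF : F.IsAcyclic)
    (hF' : F'.IsAcyclic) (ht : 0 < t) (hne : F ≠ F') :
    volume (forestSimplex F t ∩ forestSimplex F' t) = 0 := by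
  have hsub : forestSimplex F t ∩ forestSimplex F' t ⊆
      frontier (forestSimplex F t) ∪ frontier (forestSimplex F' t) := by
    rintro x ⟨hx, hx'⟩
    by_contra h
    rw [Set.mem_union, not_or] at h
    have key : ∀ {A : Set (Fin n → ℝ)}, x ∈ A → x ∉ frontier A → x ∈ interior A := by
      intro A hA hf
      by_contra hi
      exact hf ⟨subset_closure hA, hi⟩
    exact hne (eq_of_mem_interior hF hF' ht (key hx h.1) (key hx' h.2))
  refine measure_mono_null hsub (measure_union_null ?_ ?_)
  · exact (convex_forestSimplex hF ht).addHaar_frontier _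
  · exact (convex_forestSimplex hF' ht).addHaar_frontier _

/-- The fibers of `Phi` partition the graphs, so the normalized volumes add up to the generating
function of all graphs, which is the normalized volume of the polytope. -/
theorem volume_iUnion_forestSimplex (ht : 0 < t) :
    volume (⋃ F : {F : SimpleGraph (Fin (n + 1)) // F.IsAcyclic}, forestSimplex F.1 t) =
      volume (gayleyPolytope n t) := by
  classical
  have h0 : (n ! : ℝ≥0∞) ≠ 0 := by exact_mod_cast n.factorial_ne_zero
  have htop : (n ! : ℝ≥0∞) ≠ ⊤ := ENNReal.natCast_ne_top _
  rw [← ENNReal.mul_right_inj h0 htop, volume_gayleyPolytope n ht.le,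
    measure_iUnion₀ (fun F F' hne => volume_inter_forestSimplex F.2 F'.2 ht
      fun h => hne (Subtype.ext h))
      fun F => (isCompact_forestSimplex F.2 ht).isClosed.measurableSet.nullMeasurableSet,
    tsum_fintype, Finset.mul_sum]
  have h1 : ∀ F : {F : SimpleGraph (Fin (n + 1)) // F.IsAcyclic},
      (n ! : ℝ≥0∞) * volume (forestSimplex F.1 t) =
        ENNReal.ofReal (∑ G : SimpleGraph (Fin (n + 1)) with Phi G = F.1, t ^ G.edgeSet.ncard) := by
    intro F
    rw [volume_forestSimplex F.2 ht, sum_pow_ncard_edgeSet_phi_eq F.2]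
  simp only [h1]
  rw [← ENNReal.ofReal_sum_of_nonneg
    fun F _ => Finset.sum_nonneg fun G _ => pow_nonneg ht.le _, sum_isAcyclic_sum_phi_eq,
    sum_pow_ncard_edgeSet, Fintype.card_fin]

/-- The union is closed and has full measure in the polytope. A missing point would lie in the
closure of the interior, so the complement of the union would meet that interior in a nonempty open
set, which has positive volume. -/
theorem iUnion_forestSimplex (ht : 0 < t) :
    ⋃ F : {F : SimpleGraph (Fin (n + 1)) // F.IsAcyclic}, forestSimplex F.1 t =
      gayleyPolytope n t := by
  set U := ⋃ F : {F : SimpleGraph (Fin (n + 1)) // F.IsAcyclic}, forestSimplex F.1 t with hU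
  have hsub : U ⊆ gayleyPolytope n t := Set.iUnion_subset fun F => forestSimplex_subset F.2 ht
  have hclosed : IsClosed U :=
    isClosed_iUnion_of_finite fun F => (isCompact_forestSimplex F.2 ht).isClosed
  have hvol : volume (gayleyPolytope n t) ≠ 0 ∧ volume (gayleyPolytope n t) ≠ ⊤ := by
    have h := volume_gayleyPolytope n ht.le
    constructor
    · intro h'
      rw [h', mul_zero, eq_comm, ENNReal.ofReal_eq_zero] at h
      have : (0 : ℝ) < (1 + t) ^ (n + 1).choose 2 := by positivity
      linarith
    · intro h'
      rw [h', ENNReal.mul_top (by exact_mod_cast n.factorial_ne_zero)] at h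
      exact ENNReal.ofReal_ne_top h.symm
  have hnull : volume (gayleyPolytope n t \ U) = 0 := by
    rw [measure_sdiff hsub hclosed.measurableSet.nullMeasurableSet
      (by rw [volume_iUnion_forestSimplex ht]; exact hvol.2), volume_iUnion_forestSimplex ht,
      tsub_self]
  have hconv := convex_gayleyPolytope (n := n) ht.le
  have hint : (interior (gayleyPolytope n t)).Nonempty := by
    by_contra h
    rw [Set.not_nonempty_iff_eq_empty] at h
    refine hvol.1 (measure_mono_null ?_ (hconv.addHaar_frontier volume))
    intro x hx
    exact ⟨subset_closure hx, by rw [h]; exact Set.notMem_empty x⟩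
  refine Set.Subset.antisymm hsub fun x hx => ?_
  by_contra hxU
  have hcl : x ∈ closure (interior (gayleyPolytope n t)) := by
    rw [hconv.closure_interior_eq_closure_of_nonempty_interior hint]
    exact subset_closure hx
  have hne := mem_closure_iff.1 hcl Uᶜ hclosed.isOpen_compl hxU
  refine ((hclosed.isOpen_compl.inter isOpen_interior).measure_pos volume hne).ne' ?_
  exact measure_mono_null
    (show _ ⊆ gayleyPolytope n t \ U from fun y hy => ⟨interior_subset hy.2, hy.1⟩) hnull

theorem isTriangulation_forestSimplex (n : ℕ) (ht : 0 < t) :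
    IsTriangulation
      (fun F : {F : SimpleGraph (Fin (n + 1)) // F.IsAcyclic} => forestSimplex F.1 t)
      (gayleyPolytope n t) where
  simplex F := isFullSimplex_forestSimplex F.2 ht
  cover := iUnion_forestSimplex ht
  disjoint_interior F F' hne := Set.disjoint_left.2 fun _ hx hx' =>
    hne (Subtype.ext (eq_of_mem_interior F.2 F'.2 ht hx hx'))
  inter_face F F' := ⟨isExposed_inter F.2 F'.2 ht, by
    rw [Set.inter_comm]
    exact isExposed_inter F'.2 F.2 ht⟩

end Triangulation

/-! ### A forest simplex that is not an orthoscheme -/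

section Orthoscheme

/-- The forest on three nodes whose only edge joins the two smallest ones. -/
def smallEdge : SimpleGraph (Fin 3) := SimpleGraph.edge 0 1

theorem smallEdge_adj {a b : Fin 3} :
    smallEdge.Adj a b ↔ (a = 0 ∧ b = 1) ∨ (a = 1 ∧ b = 0) := by
  unfold smallEdge
  rw [SimpleGraph.edge_adj]
  fin_cases a <;> fin_cases b <;> simp

theorem smallEdge_isAcyclic : smallEdge.IsAcyclic := by
  have h : ¬ (⊥ : SimpleGraph (Fin 3)).Reachable 0 1 := by
    rw [SimpleGraph.reachable_bot]
    decide
  have := (SimpleGraph.isAcyclic_add_edge_iff_of_not_reachable (G := ⊥) 0 1 h).2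
    SimpleGraph.isAcyclic_bot
  rwa [bot_sup_eq] at this

theorem root_smallEdge : root smallEdge 0 = 1 ∧ root smallEdge 1 = 1 := by
  have h01 : smallEdge.Adj 0 1 := smallEdge_adj.2 (by simp)
  have h : root smallEdge 1 = 1 := by
    have h1 := le_root smallEdge 1
    have h2 : root smallEdge 1 ≠ 2 := by
      intro h
      have h3 := root_reachable smallEdge 1
      rw [h] at h3
      obtain ⟨W⟩ := h3.symm
      have := W.adj_snd (SimpleGraph.Walk.not_nil_of_ne (by decide))
      rw [smallEdge_adj] at this
      simp at this
    generalize root smallEdge 1 = r at h1 h2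
    fin_cases r <;> simp_all
  exact ⟨(root_eq_of_reachable h01.reachable).trans h, h⟩

theorem numCanePaths_smallEdge : numCanePaths smallEdge 0 = 0 := by
  classical
  have h01 : smallEdge.Adj 0 1 := smallEdge_adj.2 (by simp)
  have hp : IsParent smallEdge 1 0 := by
    rcases isParent_or_isParent smallEdge_isAcyclic h01 with h | h
    · exact absurd root_smallEdge.2.symm h.ne_root
    · exact h
  rw [numCanePaths_of_isParent smallEdge_isAcyclic hp, numCanePaths_of_eq_root root_smallEdge.2,
    zero_add, Finset.card_eq_zero, Finset.filter_eq_empty_iff]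
  rintro w - ⟨hw, h0⟩
  have := smallEdge_adj.1 hw.1
  rcases this with ⟨rfl, -⟩ | ⟨-, h⟩
  · exact lt_irrefl _ h0
  · simp at h

theorem position_smallEdge : position smallEdge 0 = 2 ∧ position smallEdge 1 = 1 := by
  have hF := smallEdge_isAcyclic
  have h2 : position smallEdge (Fin.last 2) = 0 := (position_eq_zero_iff hF).2 rfl
  have h01 : ¬ position smallEdge 0 < position smallEdge 1 := by
    intro h
    have := lt_root_of_position_lt hF h
    rw [root_smallEdge.1] at this
    exact lt_irrefl _ this
  have l0 : position smallEdge 0 < 3 := by simpa using position_lt smallEdge 0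
  have l1 : position smallEdge 1 < 3 := by simpa using position_lt smallEdge 1
  have n01 : position smallEdge 0 ≠ position smallEdge 1 := fun h =>
    absurd (position_injective smallEdge h) (by decide)
  have n0 : position smallEdge 0 ≠ 0 := fun h =>
    absurd ((position_eq_zero_iff hF).1 h) (by decide)
  have n1 : position smallEdge 1 ≠ 0 := fun h =>
    absurd ((position_eq_zero_iff hF).1 h) (by decide)
  omega

theorem mem_forestSimplex_smallEdge {t : ℝ} (ht : 0 < t) {x : Fin 2 → ℝ} :
    x ∈ forestSimplex smallEdge t ↔ 0 ≤ x 1 - x 0 ∧ x 1 - x 0 ≤ t * x 0 ∧ t * x 0 ≤ t := by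
  rw [mem_forestSimplex_iff smallEdge_isAcyclic ht.le]
  have h0 : nodeCoords smallEdge t x 0 = x 1 - x 0 := by
    change coord smallEdge t x 0 = _
    unfold coord
    rw [root_smallEdge.1, if_neg (by decide), position_smallEdge.1, position_smallEdge.2,
      numCanePaths_smallEdge]
    simp [xCoord]
  have h1 : nodeCoords smallEdge t x 1 = t * x 0 := by
    change coord smallEdge t x 1 = _
    unfold coord
    rw [root_smallEdge.2, if_pos rfl, position_smallEdge.2]
    simp [xCoord]
  constructor
  · rintro ⟨hm, hb⟩
    rw [← h0, ← h1]
    exact ⟨(hb 0).1, hm (by decide), (hb 1).2⟩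
  · rintro ⟨a, b, c⟩
    rw [← h0] at a b
    rw [← h1] at b c
    refine ⟨fun i j hij => ?_, fun i => ?_⟩
    · fin_cases i <;> fin_cases j <;> simp_all
    · fin_cases i
      · exact ⟨a, b.trans c⟩
      · exact ⟨a.trans b, c⟩

/-- The triangle has the vertices `(0, 0)`, `(1, 1)` and `(1, 1 + t)`. Consecutive vertices of an
orthoscheme agree in one of the two coordinates, but `(0, 0)` agrees in no coordinate with either of
the others. -/
theorem not_isOrthoscheme_smallEdge {t : ℝ} (ht : 0 < t) :
    ¬ IsOrthoscheme (forestSimplex smallEdge t) := by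
  rintro ⟨ℓ, σ, b, -, hS⟩
  let p : Fin 3 → Fin 2 → ℝ := fun k i => if (i : ℕ) < k then ℓ i else 0
  let a : Fin 3 → Fin 2 → ℝ := fun k i => p k (σ i) + b i
  have ha : ∀ k, a k ∈ forestSimplex smallEdge t := by
    intro k
    rw [hS]
    exact ⟨p k, subset_convexHull ℝ _ ⟨k, rfl⟩, rfl⟩
  -- The origin lies in the triangle; if all vertices had positive first coordinate, so would their
  -- hull. The only point of the triangle with nonpositive first coordinate is the origin, so it
  -- must be a vertex. The next claim treats `(1, 1 + t)` in the same way.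
  have hmin : ∃ k, a k 0 ≤ 0 := by
    by_contra! hall
    have h0 : (0 : Fin 2 → ℝ) ∈ forestSimplex smallEdge t := by
      rw [mem_forestSimplex_smallEdge ht]
      simp [ht.le]
    rw [hS] at h0
    obtain ⟨y, hy, hy0⟩ := h0
    have hconv : Convex ℝ {y : Fin 2 → ℝ | -b 0 < y (σ 0)} :=
      convex_halfSpace_gt (LinearMap.proj (σ 0) : (Fin 2 → ℝ) →ₗ[ℝ] ℝ).isLinear _
    have h1 := convexHull_min (s := Set.range p) (by
      rintro _ ⟨k, rfl⟩
      have : 0 < p k (σ 0) + b 0 := hall k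
      change -b 0 < p k (σ 0)
      linarith) hconv hy
    have h2 : y (σ 0) + b 0 = 0 := congrFun hy0 0
    have h1 : -b 0 < y (σ 0) := h1
    linarith
  have hmax : ∃ k, 1 + t ≤ a k 1 := by
    by_contra! hall
    have h0 : (![1, 1 + t] : Fin 2 → ℝ) ∈ forestSimplex smallEdge t := by
      rw [mem_forestSimplex_smallEdge ht]
      simp [ht.le]
    rw [hS] at h0
    obtain ⟨y, hy, hy0⟩ := h0
    have hconv : Convex ℝ {y : Fin 2 → ℝ | y (σ 1) < 1 + t - b 1} :=
      convex_halfSpace_lt (LinearMap.proj (σ 1) : (Fin 2 → ℝ) →ₗ[ℝ] ℝ).isLinear _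
    have h1 := convexHull_min (s := Set.range p) (by
      rintro _ ⟨k, rfl⟩
      have : p k (σ 1) + b 1 < 1 + t := hall k
      change p k (σ 1) < 1 + t - b 1
      linarith) hconv hy
    have h2 : y (σ 1) + b 1 = 1 + t := by simpa using congrFun hy0 1
    have h1 : y (σ 1) < 1 + t - b 1 := h1
    linarith
  obtain ⟨k, hk⟩ := hmin
  obtain ⟨l, hl⟩ := hmax
  have hmem := fun k => (mem_forestSimplex_smallEdge ht).1 (ha k)
  have hk' : a k 0 = 0 ∧ a k 1 = 0 := by
    obtain ⟨h1, h2, h3⟩ := hmem k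
    have : 0 ≤ t * a k 0 := h1.trans h2
    have := nonneg_of_mul_nonneg_right this ht
    have h4 : a k 0 = 0 := le_antisymm hk this
    rw [h4] at h1 h2
    exact ⟨h4, by linarith⟩
  have hl' : a l 0 = 1 ∧ a l 1 = 1 + t := by
    obtain ⟨h1, h2, h3⟩ := hmem l
    have h4 : a l 0 ≤ 1 := by
      by_contra! h
      nlinarith
    have h5 : t * a l 0 ≤ t := h3
    exact ⟨by nlinarith, by nlinarith⟩
  -- The first two vertices of the path differ only in the coordinate with index `0` before the
  -- permutation, so they agree where `σ i = 1`.
  have hshare01 : a 0 0 = a 1 0 ∨ a 0 1 = a 1 1 := by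
    have h : ∃ i, σ i = 1 := σ.surjective 1
    obtain ⟨i, hi⟩ := h
    have : a 0 i = a 1 i := by simp [a, p, hi]
    fin_cases i
    · exact Or.inl this
    · exact Or.inr this
  have hshare12 : a 1 0 = a 2 0 ∨ a 1 1 = a 2 1 := by
    have h : ∃ i, σ i = 0 := σ.surjective 0
    obtain ⟨i, hi⟩ := h
    have : a 1 i = a 2 i := by simp [a, p, hi]
    fin_cases i
    · exact Or.inl this
    · exact Or.inr this
  obtain ⟨m1, m2, -⟩ := hmem 1
  have m3 : a 1 0 = 0 → a 1 1 ≤ 0 := by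
    intro h
    rw [h] at m2
    linarith
  clear_value a
  clear hk hl hmem ha hS
  -- If `k` and `l` are neighbors on the path, the vertices would have to share a coordinate. If
  -- they are its ends, the middle vertex shares a coordinate with each, and `m1`, `m3` exclude the
  -- mixed points `(1, 0)` and `(0, 1 + t)`.
  fin_cases k <;> fin_cases l <;>
    simp only [Fin.zero_eta, Fin.mk_one, Fin.reduceFinMk] at hk' hl' <;>
    obtain ⟨k0, k1⟩ := hk' <;> obtain ⟨l0, l1⟩ := hl' <;>
    rcases hshare01 with h | h <;> rcases hshare12 with h' | h' <;>
    first
    | linarith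
    | exact absurd (m3 (by linarith)) (by linarith)

end Orthoscheme

end

end TGayley

open scoped Nat ENNReal Classical in
theorem theorem6p3 (t : ℝ) (ht : 0 ≤ t) :
    (∀ n : ℕ,
      -- the generating functions of graphs
      (∀ F : SimpleGraph (Fin (n + 1)), F.IsAcyclic →
        ∑ G : SimpleGraph (Fin (n + 1)) with TGayley.Phi G = F, t ^ G.edgeSet.ncard =
          t ^ F.edgeSet.ncard * (1 + t) ^ TGayley.alpha F) ∧
      ∑ G : SimpleGraph (Fin (n + 1)), t ^ G.edgeSet.ncard = (1 + t) ^ (n + 1).choose 2 ∧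
      -- the volume of the polytope
      (n ! : ℝ≥0∞) * MeasureTheory.volume (TGayley.gayleyPolytope n t) =
        ENNReal.ofReal (∑ G : SimpleGraph (Fin (n + 1)), t ^ G.edgeSet.ncard) ∧
      -- the simplices, their volumes, and the triangulation
      (0 < t →
        (∀ F : SimpleGraph (Fin (n + 1)), F.IsAcyclic →
          TGayley.IsFullSimplex (TGayley.forestSimplex F t) ∧
          (n ! : ℝ≥0∞) * MeasureTheory.volume (TGayley.forestSimplex F t) =
            ENNReal.ofReal
              (∑ G : SimpleGraph (Fin (n + 1)) with TGayley.Phi G = F, t ^ G.edgeSet.ncard)) ∧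
        TGayley.IsTriangulation
          (fun F : {F : SimpleGraph (Fin (n + 1)) // F.IsAcyclic} => TGayley.forestSimplex F.1 t)
          (TGayley.gayleyPolytope n t))) ∧
    -- the simplices are not orthoschemes in general
    (0 < t → ∃ (n : ℕ) (F : SimpleGraph (Fin (n + 1))), F.IsAcyclic ∧
      ¬ TGayley.IsOrthoscheme (TGayley.forestSimplex F t)) := by
  refine ⟨fun n => ⟨fun F hF => ?_, ?_, ?_, fun ht0 => ⟨fun F hF => ⟨?_, ?_⟩, ?_⟩⟩, fun ht0 => ?_⟩
  · exact TGayley.sum_pow_ncard_edgeSet_phi_eq hF t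
  · rw [TGayley.sum_pow_ncard_edgeSet, Fintype.card_fin]
  · rw [TGayley.volume_gayleyPolytope n ht, TGayley.sum_pow_ncard_edgeSet, Fintype.card_fin]
  · exact TGayley.isFullSimplex_forestSimplex hF ht0
  · rw [TGayley.volume_forestSimplex hF ht0, TGayley.sum_pow_ncard_edgeSet_phi_eq hF t]
  · exact TGayley.isTriangulation_forestSimplex n ht0
  · exact ⟨2, TGayley.smallEdge, TGayley.smallEdge_isAcyclic,
      TGayley.not_isOrthoscheme_smallEdge ht0⟩
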